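/- Let $q>0$, $n\in\mathbb N$, and write $[x]=\frac{q^{x/2}-q^{-x/2}}{q^{1/2}-q^{-1/2}}$ (with $[x]=x$ if $q=1$). On the Fock space with orthonormal basis the occupation states $|s\rangle$, $s\in\mathbb N^{2n}$, let $a_i,a_i^\dagger,b_i,b_i^\dagger$ ($1\le i\le n$) be $n$ commuting pairs of $q$-bosons, $a|k\rangle=\sqrt{[k]}\,|k-1\rangle$, $a^\dagger|k\rangle=\sqrt{[k+1]}\,|k+1\rangle$, with number operators $N_{a_i},N_{b_i}$ and $N_i=N_{a_i}+N_{b_i}$. For each $i$ define the two-component operators (component $A=-\frac12$ first, then $A=+\frac12$) $$t_i^-=\begin{pmatrix}q^{N_{b_i}/4}a_i\\ q^{-N_{a_i}/4}b_i\end{pmatrix},\quad t_i^+=\begin{pmatrix}-b_i^\dagger q^{-(N_{a_i}+1)/4}\\ a_i^\dagger q^{(N_{b_i}+1)/4}\end{pmatrix},\quad \tau_i^-=\begin{pmatrix}q^{-N_{b_i}/4}a_i\\ q^{N_{a_i}/4}b_i\end{pmatrix},\quad \tau_i^+=\begin{pmatrix}-b_i^\dagger q^{(N_{a_i}+1)/4}\\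 a_i^\dagger q^{-(N_{b_i}+1)/4}\end{pmatrix},$$ and $M_i=\begin{pmatrix}K_i^{-1}&-q^{1/4}(q^{1/2}-q^{-1/2})\,a_ib_i^\dagger\\0&K_i\end{pmatrix}$ with $K_i=q^{(N_{a_i}-N_{b_i})/4}$. For $i<j$ and $\epsilon,\epsilon'\in\{+,-\}$ put $$\mathbf E_{ij}^{\epsilon,\epsilon'}=q^{\frac{\epsilon}{4}\sum_{i<k<j}N_k}\sum_{A,B=\pm\frac12}(-1)^{\frac12+\epsilon A}q^{\frac A2}\,t^{\epsilon}_{i,-A}\,(M_{i+1}\cdots M_{j-1})_A{}^B\,\tau^{\epsilon'}_{j,B},$$ and set $E_{ij}=\mathbf E^{+,-}_{ij}$, $E_{ji}=\mathbf E^{-,+}_{ij}$, $F_{ij}=-F_{ji}=\mathbf E^{-,-}_{ij}$, $\tilde F_{ij}=-\tilde F_{ji}=-\mathbf E^{+,+}_{ij}$ for $i<j$, $F_{ii}=\tilde F_{ii}=0$ and $E_{ii}=E_i=N_i+1$. All indices below lie in $\{1,\dots,n\}$. (a) For $p>1$, $$F_{i,i+p}=F_{i,i+p-1}E_{i+p-1,i+p}-q^{\frac12}E_{i+p-1,i+p}F_{i,i+p-1}=q^{-\frac{N_{i+1}}2}\big(F_{i+1,i+p}E_{i+1,i}-q^{-\frac12}E_{i+1,i}F_{i+1,i+p}\big),$$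 $$\tilde F_{i,i+p}=E_{i+p,i+p-1}\tilde F_{i,i+p-1}-q^{-\frac12}\tilde F_{i,i+p-1}E_{i+p,i+p-1}=q^{\frac{N_{i+1}}2}\big(E_{i,i+1}\tilde F_{i+1,i+p}-q^{\frac12}\tilde F_{i+1,i+p}E_{i,i+1}\big).$$ (b) The $E_{ij}$ satisfy the relations of the Cartan–Weyl generators of $U_q(\mathfrak u(n))$: $[E_i,E_j]=0$, $[E_i,E_{j,j+1}]=(\delta_{ij}-\delta_{i,j+1})E_{j,j+1}$, $[E_i,E_{j+1,j}]=(\delta_{i,j+1}-\delta_{ij})E_{j+1,j}$, $[E_{i,i+1},E_{j+1,j}]=\delta_{ij}[E_i-E_{i+1}]$, and for $j>i+1$ $$E_{ij}=q^{\frac{N_{j-1}}2}(E_{i,j-1}E_{j-1,j}-q^{\frac12}E_{j-1,j}E_{i,j-1}),\qquad E_{ji}=q^{-\frac{N_{j-1}}2}(E_{j,j-1}E_{j-1,i}-q^{-\frac12}E_{j-1,i}E_{j,j-1}).$$ (c) Moreover $$E_{i,i+1}F_{j,j+1}-q^{-\frac12\delta_{i,j+1}}F_{j,j+1}E_{i,i+1}=\delta_{i,j+1}\,q^{-\frac12}F_{i+1,i-1},$$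 $$q^{-\frac12\delta_{i,j-1}}E_{i+1,i}F_{j,j+1}-F_{j,j+1}E_{i+1,i}=-\delta_{i,j-1}\,q^{\frac{E_{i+1}-1}2}F_{i,i+2},$$ $$E_{i,i+1}\tilde F_{j,j+1}-q^{\frac12\delta_{i,j-1}}\tilde F_{j,j+1}E_{i,i+1}=\delta_{i,j-1}\,q^{-\frac{E_{i+1}-1}2}\tilde F_{i,i+2},$$ $$q^{\frac12\delta_{i,j+1}}E_{i+1,i}\tilde F_{j,j+1}-\tilde F_{j,j+1}E_{i+1,i}=-\delta_{i,j+1}\,q^{\frac12}\tilde F_{i+1,i-1},$$ $$[E_i,F_{j,j+1}]=-(\delta_{ij}+\delta_{i,j+1})F_{j,j+1},\qquad [E_i,\tilde F_{j,j+1}]=(\delta_{ij}+\delta_{i,j+1})\tilde F_{j,j+1},$$ $$F_{i,i+1}\tilde F_{j,j+1}-q^{\frac12(\delta_{i,j-1}-\delta_{i,j+1})}\tilde F_{j,j+1}F_{i,i+1}=\delta_{ij}[E_i+E_{i+1}]-\delta_{i,j-1}E_{i+2,i}-\delta_{i,j+1}E_{i-1,i+1},$$ $$[F_{i,i+1},F_{j,j+1}]=[\tilde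 F_{i,i+1},\tilde F_{j,j+1}]=0.$$ In particular $[F_{i,i+1},\tilde F_{i,i+1}]=[E_i+E_{i+1}]$. (d) Let $U_q(\mathfrak{so}^*(2n))$ be the algebra of operators generated by the $E_i$, $q^{\pm E_i/2}$, $E_{i,i+1}$, $E_{i+1,i}$, $F_{i,i+1}$, $\tilde F_{i,i+1}$, and $U_q(\mathfrak u(n))$ the one generated by the $E_i$, $q^{\pm E_i/2}$, $E_{i,i+1}$, $E_{i+1,i}$. Then $U_q(\mathfrak u(n))\subseteq U_q(\mathfrak{so}^*(2n))$; all $E_{ij}$ lie in the former and all $F_{ij},\tilde F_{ij}$ in the latter. (e) This is a $q$-deformation of $\mathfrak{so}^*(2n)$: as $q\to1$ all matrix elements of $E_{ij},F_{ij},\tilde F_{ij}$ in the occupation basis converge to those at $q=1$, and at $q=1$, for all $i,j,k,l$, $$[E_{ij},E_{kl}]=\delta_{jk}E_{il}-\delta_{il}E_{kj},\quad [E_{ij},F_{kl}]=\delta_{il}F_{jk}-\delta_{ik}F_{jl},\quad [E_{ij},\tilde F_{kl}]=\delta_{jk}\tilde F_{il}-\delta_{jl}\tilde F_{ik},$$ $$[F_{ij},\tilde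 F_{kl}]=\delta_{jl}E_{ki}+\delta_{ik}E_{lj}-\delta_{jk}E_{li}-\delta_{il}E_{kj},\quad [F_{ij},F_{kl}]=[\tilde F_{ij},\tilde F_{kl}]=0.$$ -/

import Mathlib

open Filter Topology

noncomputable section

namespace QSpin

/-- The q-number `[x] = (q^{x/2} - q^{-x/2}) / (q^{1/2} - q^{-1/2})`, with its limiting value `[x] = x`
at `q = 1`. -/
def qInt (q x : ℝ) : ℝ :=
  if q = 1 then x
  else (q ^ (x / 2) - q ^ (-x / 2)) / (q ^ (1 / 2 : ℝ) - q ^ (-1 / 2 : ℝ))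

/-- Occupation numbers of the `2 n` oscillators: `s (i, 0)` is the occupation number of the
`a`-oscillator and `s (i, 1)` that of the `b`-oscillator at the `i`-th edge. -/
abbrev Occ (n : ℕ) : Type := Fin n × Fin 2 → ℕ

/-- The (algebraic) Fock space with orthonormal basis the occupation number states. -/
abbrev Fock (n : ℕ) : Type := Occ n →₀ ℂ

/-- Operators on the Fock space. -/
abbrev Op (n : ℕ) : Type := Module.End ℂ (Fock n)

variable {n : ℕ}

/-- The diagonal operator `|s⟩ ↦ c s |s⟩`; functions of the number operators are of this form. -/
def diagOp (c : Occ n → ℝ) : Op n :=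
  Finsupp.linearCombination ℂ fun s => Finsupp.single s (c s : ℂ)

/-- The operator `q ^ f`, for `f` a function of the number operators. -/
def qPow (q : ℝ) (f : Occ n → ℝ) : Op n := diagOp fun s => q ^ f s

/-- The operator `[f]`, for `f` a function of the number operators. -/
def qNum (q : ℝ) (f : Occ n → ℝ) : Op n := diagOp fun s => qInt q (f s)

/-- q-boson annihilation operator of the mode `m`: `|k⟩ ↦ √[k] |k - 1⟩` (zero on `|0⟩`). -/
def annih (q : ℝ) (m : Fin n × Fin 2) : Op n :=
  Finsupp.linearCombination ℂ fun s =>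
    Finsupp.single (Function.update s m (s m - 1)) (Real.sqrt (qInt q (s m)) : ℂ)

/-- q-boson creation operator of the mode `m`: `|k⟩ ↦ √[k + 1] |k + 1⟩`. -/
def creat (q : ℝ) (m : Fin n × Fin 2) : Op n :=
  Finsupp.linearCombination ℂ fun s =>
    Finsupp.single (Function.update s m (s m + 1)) (Real.sqrt (qInt q (s m + 1)) : ℂ)

/-- Eigenvalue of `N_a` at the edge `i`. -/
def numA (i : Fin n) (s : Occ n) : ℝ := (s (i, 0) : ℝ)

/-- Eigenvalue of `N_b` at the edge `i`. -/
def numB (i : Fin n) (s : Occ n) : ℝ := (s (i, 1) : ℝ)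

/-- Eigenvalue of `N_i = N_a + N_b` at the edge `i`. -/
def num (i : Fin n) (s : Occ n) : ℝ := numA i s + numB i s

/-- The `U_q(su(2))` spinors `t^ε` at the edge `i` (`ε = true` is `+`, `ε = false` is `-`).
The component index `0` stands for `A = -1/2` and `1` for `A = 1/2`. -/
def tSpinor (q : ℝ) (i : Fin n) : Bool → Fin 2 → Op n
  | false => ![qPow q (fun s => numB i s / 4) * annih q (i, 0),
               qPow q (fun s => -numA i s / 4) * annih q (i, 1)]
  | true => ![-(creat q (i, 1) * qPow q (fun s => -(numA i s + 1) / 4)),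
              creat q (i, 0) * qPow q (fun s => (numB i s + 1) / 4)]

/-- The `U_{q⁻¹}(su(2))` spinors `τ^ε` at the edge `i`, with the same index conventions. -/
def tauSpinor (q : ℝ) (i : Fin n) : Bool → Fin 2 → Op n
  | false => ![qPow q (fun s => -numB i s / 4) * annih q (i, 0),
               qPow q (fun s => numA i s / 4) * annih q (i, 1)]
  | true => ![-(creat q (i, 1) * qPow q (fun s => (numA i s + 1) / 4)),
              creat q (i, 0) * qPow q (fun s => -(numB i s + 1) / 4)]

/-- The flux `S(L)†` at the edge `i`, where
`S(L) = !![K⁻¹, 0; -q^{1/4} (q^{1/2} - q^{-1/2}) J₊, K]`, `K = q^{(N_a - N_b)/4}`, `J₊ = a† b`,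
so that `K† = K` and `J₊† = J₋ = a b†`. -/
def flux (q : ℝ) (i : Fin n) : Matrix (Fin 2) (Fin 2) (Op n) :=
  !![qPow q (fun s => -(numA i s - numB i s) / 4),
     -((q ^ (1 / 4 : ℝ) * (q ^ (1 / 2 : ℝ) - q ^ (-1 / 2 : ℝ))) •
        (annih q (i, 0) * creat q (i, 1)));
     0,
     qPow q (fun s => (numA i s - numB i s) / 4)]

/-- Parallel transport from the edge `j` to the edge `i`: the product, in increasing order, of the
fluxes at the edges strictly between `i` and `j`. -/
def transport (q : ℝ) (i j : Fin n) : Matrix (Fin 2) (Fin 2) (Op n) :=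
  (((List.finRange n).filter fun k => i < k ∧ k < j).map fun k => flux q k).prod

/-- The magnetic number `A = ∓ 1/2` of a spinor component. -/
def mag (A : Fin 2) : ℝ := if A = 0 then -1 / 2 else 1 / 2

/-- The sign `(-1)^{1/2 + A}` for `ε = +` and `(-1)^{1/2 - A}` for `ε = -`. -/
def spinSign (ε : Bool) (A : Fin 2) : ℝ :=
  if ε then (-1) ^ (A : ℕ) else (-1) ^ (1 - (A : ℕ))

/-- The quadratic observable `E_{ij}^{ε, ε'}` for `i < j`: with `± = ε`,
`q^{± ∑_{i<k<j} N_k / 4} ∑_{A, B} (-1)^{1/2 ± A} q^{A/2} t^ε_{i,-A} (∏_{i<k<j} S(L_k)†)_A^B τ^{ε'}_{j,B}`. -/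
def obs (q : ℝ) (ε ε' : Bool) (i j : Fin n) : Op n :=
  qPow q (fun s => (if ε then 1 else -1) * (∑ k ∈ Finset.Ioo i j, num k s) / 4) *
    ∑ A : Fin 2, ∑ B : Fin 2,
      (spinSign ε A * q ^ (mag A / 2)) •
        (tSpinor q i ε A.rev * transport q i j A B * tauSpinor q j ε' B)

/-- The operators `𝓔_{ij}`; in particular `𝓔_{ii} = 𝓔_i = N_i + 1`. -/
def E (q : ℝ) (i j : Fin n) : Op n :=
  if i < j then obs q true false i j
  else if j < i then obs q false true j i
  else diagOp fun s => num i s + 1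

/-- The operators `𝓕_{ij} = - 𝓕_{ji}`. -/
def F (q : ℝ) (i j : Fin n) : Op n :=
  if i < j then obs q false false i j
  else if j < i then -obs q false false j i
  else 0

/-- The operators `𝓕̃_{ij} = - 𝓕̃_{ji}`. -/
def Ft (q : ℝ) (i j : Fin n) : Op n :=
  if i < j then -obs q true true i j
  else if j < i then obs q true true j i
  else 0

/-- Kronecker delta. -/
def δ (i j : Fin n) : ℝ := if i = j then 1 else 0

/-- Generators of `U_q(u(n))`: `𝓔_i`, `q^{± 𝓔_i / 2}`, `𝓔_{i,i+1}` and `𝓔_{i+1,i}`. -/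
def uGenerators (q : ℝ) (n : ℕ) : Set (Op n) :=
  {X | ∃ i : Fin n, X = E q i i ∨ X = qPow q (fun s => (num i s + 1) / 2) ∨
      X = qPow q (fun s => -(num i s + 1) / 2)} ∪
  {X | ∃ i j : Fin n, (i : ℕ) + 1 = j ∧ (X = E q i j ∨ X = E q j i)}

/-- Generators of `U_q(so*(2n))`: those of `U_q(u(n))`, with `𝓕_{i,i+1}` and `𝓕̃_{i,i+1}`. -/
def soGenerators (q : ℝ) (n : ℕ) : Set (Op n) :=
  uGenerators q n ∪ {X | ∃ i j : Fin n, (i : ℕ) + 1 = j ∧ (X = F q i j ∨ X = Ft q i j)}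

/-- `U_q(u(n))` as an algebra of operators on the Fock space. -/
def Uu (q : ℝ) (n : ℕ) : Subalgebra ℂ (Op n) := Algebra.adjoin ℂ (uGenerators q n)

/-- `U_q(so*(2n))` as an algebra of operators on the Fock space. -/
def Uso (q : ℝ) (n : ℕ) : Subalgebra ℂ (Op n) := Algebra.adjoin ℂ (soGenerators q n)

end QSpin

end

set_option maxSynthPendingDepth 3

noncomputable section

namespace QSpin

variable {n : ℕ}

/-! Most of the theorem rests on one local identity. At a single edge `k`, the q-commutator of a
spinor τ with a raised spinor t of the opposite sign is the flux matrix at `k`, dressed by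
`q^{±N_k/4}` (`tau_mul_u`, `u_mul_tau`). Spinors τ and t of the same sign commute
(`commute_tau_u_false`, `commute_tau_u_true`).

Distributing the scalar prefactor over the edges turns each observable into a chain: raised t at
`i`, then dressed fluxes at the intermediate edges, then τ at `j` (`obs_eq_sum`). Operators on
disjoint sets of edges commute (`commute_of_mem_siteAlg`). So the q-commutator of a chain on `(i,
k)` with one on `(k, j)` collapses to the local q-commutator at `k` (`obs_exchange`). With opposite
signs at `k` it inserts the missing flux, which yields the recursions for `E`, `F`, `Ft` and the
relations between neighbouring generators. With equal signs the chains commute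
(`commute_obs_chain`). A factor `q^{±N_k/2}` appears exactly when the dressing of the inserted flux
has the opposite sign to that of the chain (`sum_row_true`, `sum_row_false`).

Generators on the same pair of edges need a separate computation, `SpinorRel.pair`, carried out in
an abstract ring with the one-site exchange relations. Generators on disjoint pairs commute by
locality, and brackets with `E q i i` follow from the grading by boson number. The recursions, read
as induction steps, put all observables in the generated algebras.

For `q → 1`, matrix elements are built from finite sums and products of functions continuous at 1.
At `q = 1` the fluxes are the identity, so the observables become bilinears in ordinary bosons,
whose brackets are computed in `BosonRel.lie`. -/

/-! ### Basis states and diagonal operators. -/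

theorem op_ext {X Y : Op n}
    (h : ∀ s, X (Finsupp.single s 1) = Y (Finsupp.single s 1)) : X = Y := by
  apply Finsupp.lhom_ext'
  intro s
  ext1
  exact h s

/-- Raising the occupation number of the mode `m` by one. -/
def up (s : Occ n) (m : Fin n × Fin 2) : Occ n := Function.update s m (s m + 1)

/-- Lowering the occupation number of the mode `m` by one. -/
def down (s : Occ n) (m : Fin n × Fin 2) : Occ n := Function.update s m (s m - 1)

theorem down_up (s : Occ n) (m : Fin n × Fin 2) : down (up s m) m = s := by
  simp [down, up]

theorem up_down {s : Occ n} {m : Fin n × Fin 2} (h : s m ≠ 0) : up (down s m) m = s := by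
  have : s m - 1 + 1 = s m := by omega
  simp [down, up, this]

theorem diagOp_single (c : Occ n → ℝ) (s : Occ n) :
    diagOp c (Finsupp.single s 1) = c s • Finsupp.single s (1 : ℂ) := by
  simp [diagOp]

theorem annih_single (q : ℝ) (m : Fin n × Fin 2) (s : Occ n) :
    annih q m (Finsupp.single s 1) =
      Real.sqrt (qInt q (s m)) • Finsupp.single (down s m) (1 : ℂ) := by
  simp [annih, down]

theorem creat_single (q : ℝ) (m : Fin n × Fin 2) (s : Occ n) :
    creat q m (Finsupp.single s 1) =
      Real.sqrt (qInt q (s m + 1)) • Finsupp.single (up s m) (1 : ℂ) := by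
  simp [creat, up]

theorem op_map_smul (X : Op n) (r : ℝ) (v : Fock n) : X (r • v) = r • X v :=
  LinearMap.map_smul_of_tower X r v

theorem diagOp_mul (c d : Occ n → ℝ) :
    diagOp c * diagOp d = diagOp fun s => c s * d s := by
  refine op_ext fun s => ?_
  simp only [Module.End.mul_apply, diagOp_single, op_map_smul, smul_smul]
  rw [mul_comm]

theorem diagOp_add (c d : Occ n → ℝ) :
    diagOp c + diagOp d = diagOp fun s => c s + d s := by
  refine op_ext fun s => ?_
  simp only [LinearMap.add_apply, diagOp_single, add_smul]

theorem diagOp_sub (c d : Occ n → ℝ) :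
    diagOp c - diagOp d = diagOp fun s => c s - d s := by
  refine op_ext fun s => ?_
  simp only [LinearMap.sub_apply, diagOp_single, sub_smul]

theorem smul_diagOp (r : ℝ) (c : Occ n → ℝ) :
    r • diagOp c = diagOp fun s => r * c s := by
  refine op_ext fun s => ?_
  simp only [LinearMap.smul_apply, diagOp_single, mul_smul]

theorem diagOp_one : diagOp (fun _ : Occ n => (1 : ℝ)) = 1 := by
  refine op_ext fun s => ?_
  simp [diagOp_single]

theorem commute_diagOp (c d : Occ n → ℝ) : Commute (diagOp c) (diagOp d) := by
  simp only [Commute, SemiconjBy, diagOp_mul, mul_comm]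

/-! ### q-numbers. -/

theorem qInt_zero (q : ℝ) : qInt q 0 = 0 := by
  simp [qInt]

theorem qInt_one_left (x : ℝ) : qInt 1 x = x := by
  simp [qInt]

theorem rpow_half_sub_ne {q : ℝ} (hq : 0 < q) (h1 : q ≠ 1) :
    q ^ (1 / 2 : ℝ) - q ^ (-1 / 2 : ℝ) ≠ 0 := by
  intro h
  rw [sub_eq_zero] at h
  have := (Real.rpow_right_inj hq h1).1 h
  norm_num at this

/-- Insert the cross term `q^{-x/2} q^{y/2}` in the numerator. The formula is also valid at `q = 1`,
so its consequences need no case split; the q-number identities used later come from it, mostly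
through `y = 1` or `x = 1`. -/
theorem qInt_add {q : ℝ} (hq : 0 < q) (x y : ℝ) :
    qInt q (x + y) = qInt q x * q ^ (y / 2) + q ^ (-x / 2) * qInt q y := by
  by_cases h1 : q = 1
  · simp [h1, qInt]
  · have h := rpow_half_sub_ne hq h1
    simp only [qInt, if_neg h1]
    have e1 : q ^ ((x + y) / 2) = q ^ (x / 2) * q ^ (y / 2) := by
      rw [← Real.rpow_add hq]; ring_nf
    have e2 : q ^ (-(x + y) / 2) = q ^ (-x / 2) * q ^ (-y / 2) := by
      rw [← Real.rpow_add hq]; ring_nf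
    rw [e1, e2]
    field_simp
    ring

theorem qInt_one {q : ℝ} (hq : 0 < q) : qInt q 1 = 1 := by
  by_cases h1 : q = 1
  · simp [h1, qInt]
  · simp only [qInt, if_neg h1]
    exact div_self (rpow_half_sub_ne hq h1)

theorem qInt_neg (q x : ℝ) : qInt q (-x) = -qInt q x := by
  unfold qInt
  split_ifs
  · rfl
  · rw [neg_neg]; ring

theorem qInt_add_one {q : ℝ} (hq : 0 < q) (x : ℝ) :
    qInt q (x + 1) = q ^ (1 / 2 : ℝ) * qInt q x + q ^ (-x / 2) := by
  rw [qInt_add hq, qInt_one hq]; ring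

theorem qInt_add_one' {q : ℝ} (hq : 0 < q) (x : ℝ) :
    qInt q (x + 1) = q ^ (-1 / 2 : ℝ) * qInt q x + q ^ (x / 2) := by
  rw [add_comm, qInt_add hq, qInt_one hq]; ring

theorem qInt_natCast_nonneg {q : ℝ} (hq : 0 < q) (k : ℕ) : 0 ≤ qInt q k := by
  induction k with
  | zero => simp [qInt_zero]
  | succ k ih =>
    push_cast
    rw [qInt_add_one hq]
    positivity

/-! ### q-boson exchange relations. -/

theorem annih_mul_diagOp (q : ℝ) (m : Fin n × Fin 2) (c : Occ n → ℝ) :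
    annih q m * diagOp c = diagOp (fun s => c (up s m)) * annih q m := by
  refine op_ext fun s => ?_
  simp only [Module.End.mul_apply, diagOp_single, annih_single, op_map_smul, smul_smul]
  -- On the vacuum of `m` truncated subtraction makes `up (down s m) m` differ from `s`, but the
  -- coefficient `√[0] = 0` kills both sides.
  by_cases h : s m = 0
  · simp [h, qInt_zero]
  · rw [up_down h, mul_comm]

theorem diagOp_mul_creat (q : ℝ) (m : Fin n × Fin 2) (c : Occ n → ℝ) :
    diagOp c * creat q m = creat q m * diagOp (fun s => c (up s m)) := by
  refine op_ext fun s => ?_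
  simp only [Module.End.mul_apply, diagOp_single, creat_single, op_map_smul, smul_smul]
  rw [mul_comm]

theorem annih_mul_creat {q : ℝ} (hq : 0 < q) (m : Fin n × Fin 2) :
    annih q m * creat q m = diagOp fun s => qInt q (s m + 1) := by
  refine op_ext fun s => ?_
  simp only [Module.End.mul_apply, diagOp_single, creat_single, annih_single, op_map_smul,
    smul_smul, down_up]
  have : ((up s m m : ℕ) : ℝ) = s m + 1 := by simp [up]
  rw [this, Real.mul_self_sqrt]
  exact_mod_cast qInt_natCast_nonneg hq (s m + 1)

theorem creat_mul_annih {q : ℝ} (hq : 0 < q) (m : Fin n × Fin 2) :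
    creat q m * annih q m = diagOp fun s => qInt q (s m) := by
  refine op_ext fun s => ?_
  simp only [Module.End.mul_apply, diagOp_single, creat_single, annih_single, op_map_smul,
    smul_smul]
  by_cases h : s m = 0
  · simp [h, qInt_zero]
  · have h1 : ((down s m m : ℕ) : ℝ) + 1 = s m := by
      have : down s m m + 1 = s m := by simp [down]; omega
      exact_mod_cast this
    rw [up_down h, h1, Real.mul_self_sqrt (qInt_natCast_nonneg hq _)]

theorem commute_annih (q : ℝ) {m m' : Fin n × Fin 2} (h : m ≠ m') :
    Commute (annih q m) (annih q m') := by
  refine op_ext fun s => ?_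
  simp only [Module.End.mul_apply, annih_single, op_map_smul, smul_smul]
  simp only [down, Function.update_of_ne h, Function.update_of_ne h.symm]
  rw [mul_comm, Function.update_comm h]

theorem commute_creat (q : ℝ) {m m' : Fin n × Fin 2} (h : m ≠ m') :
    Commute (creat q m) (creat q m') := by
  refine op_ext fun s => ?_
  simp only [Module.End.mul_apply, creat_single, op_map_smul, smul_smul]
  simp only [up, Function.update_of_ne h, Function.update_of_ne h.symm]
  rw [mul_comm, Function.update_comm h]

theorem commute_annih_creat (q : ℝ) {m m' : Fin n × Fin 2} (h : m ≠ m') :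
    Commute (annih q m) (creat q m') := by
  refine op_ext fun s => ?_
  simp only [Module.End.mul_apply, creat_single, annih_single, op_map_smul, smul_smul]
  simp only [up, down, Function.update_of_ne h, Function.update_of_ne h.symm]
  rw [mul_comm, Function.update_comm h]

theorem commute_diagOp_annih (q : ℝ) (m : Fin n × Fin 2) {c : Occ n → ℝ}
    (h : ∀ s, c (up s m) = c s) : Commute (diagOp c) (annih q m) := by
  have := annih_mul_diagOp q m c
  simp only [h] at this
  exact this.symm

theorem commute_diagOp_creat (q : ℝ) (m : Fin n × Fin 2) {c : Occ n → ℝ}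
    (h : ∀ s, c (up s m) = c s) : Commute (diagOp c) (creat q m) := by
  have := diagOp_mul_creat q m c
  simp only [h] at this
  exact this

theorem numA_up (i : Fin n) (s : Occ n) : numA i (up s (i, 0)) = numA i s + 1 := by
  simp [numA, up]

theorem numB_up (i : Fin n) (s : Occ n) : numB i (up s (i, 1)) = numB i s + 1 := by
  simp [numB, up]

theorem numA_up' (i : Fin n) (s : Occ n) : numA i (up s (i, 1)) = numA i s := by
  simp [numA, up]

theorem numB_up' (i : Fin n) (s : Occ n) : numB i (up s (i, 0)) = numB i s := by
  simp [numB, up]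

theorem numA_up_of_ne {i j : Fin n} (h : j ≠ i) (x : Fin 2) (s : Occ n) :
    numA i (up s (j, x)) = numA i s := by
  simp [numA, up, h.symm]

theorem numB_up_of_ne {i j : Fin n} (h : j ≠ i) (x : Fin 2) (s : Occ n) :
    numB i (up s (j, x)) = numB i s := by
  simp [numB, up, h.symm]

/-! ### Locality. -/

/-- The algebra of operators acting on the sites in `S` only. -/
def siteAlg (q : ℝ) (S : Set (Fin n)) : Subalgebra ℝ (Op n) :=
  Algebra.adjoin ℝ
    ({X | ∃ c : Occ n → ℝ, (∀ s m, m.1 ∉ S → c (up s m) = c s) ∧ X = diagOp c} ∪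
      {X | ∃ m : Fin n × Fin 2, m.1 ∈ S ∧ (X = annih q m ∨ X = creat q m)})

theorem diagOp_mem_siteAlg (q : ℝ) {S : Set (Fin n)} {c : Occ n → ℝ}
    (h : ∀ s m, m.1 ∉ S → c (up s m) = c s) : diagOp c ∈ siteAlg q S :=
  Algebra.subset_adjoin (Or.inl ⟨c, h, rfl⟩)

theorem annih_mem_siteAlg (q : ℝ) {S : Set (Fin n)} {m : Fin n × Fin 2} (h : m.1 ∈ S) :
    annih q m ∈ siteAlg q S :=
  Algebra.subset_adjoin (Or.inr ⟨m, h, Or.inl rfl⟩)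

theorem creat_mem_siteAlg (q : ℝ) {S : Set (Fin n)} {m : Fin n × Fin 2} (h : m.1 ∈ S) :
    creat q m ∈ siteAlg q S :=
  Algebra.subset_adjoin (Or.inr ⟨m, h, Or.inr rfl⟩)

theorem siteAlg_mono (q : ℝ) {S T : Set (Fin n)} (h : S ⊆ T) : siteAlg q S ≤ siteAlg q T := by
  refine Algebra.adjoin_le ?_
  rintro X (⟨c, hc, rfl⟩ | ⟨m, hm, rfl | rfl⟩)
  · exact diagOp_mem_siteAlg q fun s m hm => hc s m fun hS => hm (h hS)
  · exact annih_mem_siteAlg q (h hm)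
  · exact creat_mem_siteAlg q (h hm)

/-- Commutation passes from generators to generated algebras, so only pairs of generators matter:
distinct modes commute, and a diagonal operator commutes with modes that its eigenvalue ignores. -/
theorem commute_of_mem_siteAlg {q : ℝ} {S T : Set (Fin n)} (h : Disjoint S T) {X Y : Op n}
    (hX : X ∈ siteAlg q S) (hY : Y ∈ siteAlg q T) : Commute X Y := by
  refine Algebra.commute_of_mem_adjoin_of_forall_mem_commute hY ?_
  intro V hV
  refine (Algebra.commute_of_mem_adjoin_of_forall_mem_commute hX ?_).symm
  intro Z hZ
  symm
  have hne : ∀ m m' : Fin n × Fin 2, m.1 ∈ S → m'.1 ∈ T → m ≠ m' := by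
    rintro m m' hm hm' rfl
    exact Set.disjoint_left.1 h hm hm'
  rcases hZ with ⟨c, hc, rfl⟩ | ⟨m, hm, hm'⟩ <;> rcases hV with ⟨d, hd, rfl⟩ | ⟨m', hT, hT'⟩
  · exact commute_diagOp _ _
  · have := fun s => hc s m' (Set.disjoint_right.1 h hT)
    rcases hT' with rfl | rfl
    · exact commute_diagOp_annih q m' this
    · exact commute_diagOp_creat q m' this
  · have := fun s => hd s m (Set.disjoint_left.1 h hm)
    rcases hm' with rfl | rfl
    · exact (commute_diagOp_annih q m this).symm
    · exact (commute_diagOp_creat q m this).symm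
  · have := hne m m' hm hT
    rcases hT' with rfl | rfl <;> rcases hm' with rfl | rfl
    · exact commute_annih q this
    · exact (commute_annih_creat q this.symm).symm
    · exact commute_annih_creat q this
    · exact commute_creat q this

/-! ### One-site operators with q-power dressing. -/

/-- Annihilation of an `a`-boson with a `q`-power of `N_b`. -/
def annA (q κ : ℝ) (i : Fin n) : Op n := qPow q (fun s => κ * numB i s / 4) * annih q (i, 0)

/-- Annihilation of a `b`-boson with a `q`-power of `N_a`. -/
def annB (q κ : ℝ) (i : Fin n) : Op n := qPow q (fun s => -κ * numA i s / 4) * annih q (i, 1)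

/-- Creation of an `a`-boson with a `q`-power of `N_b`. -/
def creA (q κ : ℝ) (i : Fin n) : Op n := creat q (i, 0) * qPow q (fun s => κ * numB i s / 4)

/-- Creation of a `b`-boson with a `q`-power of `N_a`. -/
def creB (q κ : ℝ) (i : Fin n) : Op n := creat q (i, 1) * qPow q (fun s => -κ * numA i s / 4)

theorem qPow_mul {q : ℝ} (hq : 0 < q) (f g : Occ n → ℝ) :
    qPow q f * qPow q g = qPow q fun s => f s + g s := by
  simp only [qPow, diagOp_mul, Real.rpow_add hq]

theorem smul_qPow {q : ℝ} (hq : 0 < q) (r : ℝ) (f : Occ n → ℝ) :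
    q ^ r • qPow q f = qPow q fun s => r + f s := by
  simp only [qPow, smul_diagOp, Real.rpow_add hq]

theorem annih_mul_qPow (q : ℝ) (m : Fin n × Fin 2) (f : Occ n → ℝ) :
    annih q m * qPow q f = qPow q (fun s => f (up s m)) * annih q m :=
  annih_mul_diagOp q m _

theorem qPow_mul_creat (q : ℝ) (m : Fin n × Fin 2) (f : Occ n → ℝ) :
    qPow q f * creat q m = creat q m * qPow q (fun s => f (up s m)) :=
  diagOp_mul_creat q m _

theorem qPow_zero (q : ℝ) : qPow q (fun _ : Occ n => 0) = 1 := by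
  simp [qPow, diagOp_one]

theorem commute_qPow (q : ℝ) (f g : Occ n → ℝ) : Commute (qPow q f) (qPow q g) :=
  commute_diagOp _ _

theorem modes_ne (i : Fin n) : ((i, 0) : Fin n × Fin 2) ≠ (i, 1) := by
  simp

section OneSite

variable {q : ℝ}

/-- Up to scalars, `κ = 1` gives the components of t and `κ = -1` those of τ. Two independent
parameters cover both the mixed t–τ relations (`l = -κ`) and those within one kind (`l = κ`). -/
theorem annA_mul_creA (hq : 0 < q) (κ l : ℝ) (i : Fin n) : annA q κ i * creA q l i =
    diagOp fun s => q ^ ((κ + l) * numB i s / 4) * qInt q (numA i s + 1) := by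
  unfold annA creA
  rw [mul_assoc, ← mul_assoc (annih q _), annih_mul_creat hq, qPow, qPow, diagOp_mul, diagOp_mul]
  congr 1; funext s
  have : (κ + l) * numB i s / 4 = κ * numB i s / 4 + l * numB i s / 4 := by ring
  rw [this, Real.rpow_add hq]
  simp only [numA]; ring

theorem annB_mul_creB (hq : 0 < q) (κ l : ℝ) (i : Fin n) : annB q κ i * creB q l i =
    diagOp fun s => q ^ (-(κ + l) * numA i s / 4) * qInt q (numB i s + 1) := by
  unfold annB creB
  rw [mul_assoc, ← mul_assoc (annih q _), annih_mul_creat hq, qPow, qPow, diagOp_mul, diagOp_mul]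
  congr 1; funext s
  have : -(κ + l) * numA i s / 4 = -κ * numA i s / 4 + -l * numA i s / 4 := by ring
  rw [this, Real.rpow_add hq]
  simp only [numB]; ring

theorem creA_mul_annA (hq : 0 < q) (κ l : ℝ) (i : Fin n) : creA q l i * annA q κ i =
    diagOp fun s => q ^ ((κ + l) * numB i s / 4) * qInt q (numA i s) := by
  unfold annA creA
  rw [mul_assoc, ← mul_assoc (qPow q _), qPow_mul hq, ← mul_assoc]
  rw [show creat q (i, 0) * qPow q (fun s => l * numB i s / 4 + κ * numB i s / 4) =
    qPow q (fun s => l * numB i s / 4 + κ * numB i s / 4) * creat q (i, 0) by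
      simp only [qPow_mul_creat, numB_up']]
  rw [mul_assoc, creat_mul_annih hq, qPow, diagOp_mul]
  congr 1; funext s
  congr 2
  ring

theorem creB_mul_annB (hq : 0 < q) (κ l : ℝ) (i : Fin n) : creB q l i * annB q κ i =
    diagOp fun s => q ^ (-(κ + l) * numA i s / 4) * qInt q (numB i s) := by
  unfold annB creB
  rw [mul_assoc, ← mul_assoc (qPow q _), qPow_mul hq, ← mul_assoc]
  rw [show creat q (i, 1) * qPow q (fun s => -l * numA i s / 4 + -κ * numA i s / 4) =
    qPow q (fun s => -l * numA i s / 4 + -κ * numA i s / 4) * creat q (i, 1) by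
      simp only [qPow_mul_creat, numA_up']]
  rw [mul_assoc, creat_mul_annih hq, qPow, diagOp_mul]
  congr 1; funext s
  congr 2
  ring

theorem creB_mul_annA (hq : 0 < q) (κ l : ℝ) (i : Fin n) : creB q l i * annA q κ i =
    creat q (i, 1) * qPow q (fun s => (κ * numB i s - l * numA i s) / 4) * annih q (i, 0) := by
  unfold annA creB
  rw [mul_assoc, ← mul_assoc (qPow q _), qPow_mul hq, ← mul_assoc]
  congr 3; funext s; ring

theorem annA_mul_creB (hq : 0 < q) (κ l : ℝ) (i : Fin n) : annA q κ i * creB q l i =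
    q ^ ((κ - l) / 4) • (creB q l i * annA q κ i) := by
  rw [creB_mul_annA hq, ← smul_mul_assoc, ← mul_smul_comm, smul_qPow hq]
  unfold annA creB
  rw [mul_assoc, ← mul_assoc (annih q _), (commute_annih_creat q (modes_ne i)).eq, mul_assoc,
    annih_mul_qPow, ← mul_assoc, ← mul_assoc, qPow_mul_creat, mul_assoc (creat q _), qPow_mul hq]
  simp only [numA_up, numB_up]
  congr 3; funext s; ring

theorem creA_mul_annB (hq : 0 < q) (κ l : ℝ) (i : Fin n) : creA q l i * annB q κ i =
    creat q (i, 0) * qPow q (fun s => (l * numB i s - κ * numA i s) / 4) * annih q (i, 1) := by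
  unfold annB creA
  rw [mul_assoc, ← mul_assoc (qPow q _), qPow_mul hq, ← mul_assoc]
  congr 3; funext s; ring

theorem annB_mul_creA (hq : 0 < q) (κ l : ℝ) (i : Fin n) : annB q κ i * creA q l i =
    q ^ ((l - κ) / 4) • (creA q l i * annB q κ i) := by
  rw [creA_mul_annB hq, ← smul_mul_assoc, ← mul_smul_comm, smul_qPow hq]
  unfold annB creA
  rw [mul_assoc, ← mul_assoc (annih q _), (commute_annih_creat q (modes_ne i).symm).eq, mul_assoc,
    annih_mul_qPow, ← mul_assoc, ← mul_assoc, qPow_mul_creat, mul_assoc (creat q _), qPow_mul hq]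
  simp only [numA_up, numB_up]
  congr 3; funext s; ring

theorem annB_mul_annA (hq : 0 < q) (κ l : ℝ) (i : Fin n) : annB q l i * annA q κ i =
    q ^ ((κ + l) / 4) • (annA q κ i * annB q l i) := by
  unfold annA annB
  rw [mul_assoc, ← mul_assoc (annih q _), annih_mul_qPow, mul_assoc (qPow q _) (annih q (i, 0)),
    ← mul_assoc (annih q (i, 0)), annih_mul_qPow]
  simp only [← mul_assoc, qPow_mul hq, numA_up, numB_up]
  rw [mul_assoc (qPow q _), mul_assoc (qPow q _), (commute_annih q (modes_ne i)).eq,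
    ← smul_mul_assoc, smul_qPow hq]
  congr 2; funext s; ring

theorem creA_mul_creB (hq : 0 < q) (κ l : ℝ) (i : Fin n) : creA q l i * creB q κ i =
    q ^ ((κ + l) / 4) • (creB q κ i * creA q l i) := by
  unfold creA creB
  have h : ∀ (x y : Op n) (f g : Occ n → ℝ), x * qPow q f * (y * qPow q g) =
      x * (qPow q f * y) * qPow q g := fun x y f g => by noncomm_ring
  rw [h, h, qPow_mul_creat, qPow_mul_creat, ← mul_assoc, ← mul_assoc,
    (commute_creat q (modes_ne i)).eq, mul_assoc _ (qPow q _), mul_assoc _ (qPow q _),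
    qPow_mul hq, qPow_mul hq]
  simp only [numA_up, numB_up]
  rw [← mul_smul_comm, smul_qPow hq]
  congr 2; funext s; ring

end OneSite

section OneSite

variable (q κ l : ℝ) (i : Fin n)

theorem commute_annA : Commute (annA q κ i) (annA q l i) := by
  have h : ∀ μ : ℝ, Commute (qPow q fun s => μ * numB i s / 4) (annih q (i, 0)) := fun μ =>
    commute_diagOp_annih q _ fun s => by simp only [numB_up']
  exact ((commute_qPow q _ _).mul_right (h κ)).mul_left ((h l).symm.mul_right (Commute.refl _))

theorem commute_annB : Commute (annB q κ i) (annB q l i) := by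
  have h : ∀ μ : ℝ, Commute (qPow q fun s => -μ * numA i s / 4) (annih q (i, 1)) := fun μ =>
    commute_diagOp_annih q _ fun s => by simp only [numA_up']
  exact ((commute_qPow q _ _).mul_right (h κ)).mul_left ((h l).symm.mul_right (Commute.refl _))

theorem commute_creA : Commute (creA q κ i) (creA q l i) := by
  have h : ∀ μ : ℝ, Commute (qPow q fun s => μ * numB i s / 4) (creat q (i, 0)) := fun μ =>
    commute_diagOp_creat q _ fun s => by simp only [numB_up']
  exact ((Commute.refl _).mul_right (h l).symm).mul_left ((h κ).mul_right (commute_qPow q _ _))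

theorem commute_creB : Commute (creB q κ i) (creB q l i) := by
  have h : ∀ μ : ℝ, Commute (qPow q fun s => -μ * numA i s / 4) (creat q (i, 1)) := fun μ =>
    commute_diagOp_creat q _ fun s => by simp only [numA_up']
  exact ((Commute.refl _).mul_right (h l).symm).mul_left ((h κ).mul_right (commute_qPow q _ _))

end OneSite

section Membership

variable (q κ : ℝ) (i : Fin n)

theorem qPow_mem_siteAlg {S : Set (Fin n)} {f : Occ n → ℝ}
    (h : ∀ s m, m.1 ∉ S → f (up s m) = f s) : qPow q f ∈ siteAlg q S :=
  diagOp_mem_siteAlg q fun s m hm => by rw [h s m hm]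

theorem annA_mem : annA q κ i ∈ siteAlg q {i} :=
  mul_mem (qPow_mem_siteAlg q fun s m hm => by rw [numB_up_of_ne (by simpa using hm)])
    (annih_mem_siteAlg q rfl)

theorem annB_mem : annB q κ i ∈ siteAlg q {i} :=
  mul_mem (qPow_mem_siteAlg q fun s m hm => by rw [numA_up_of_ne (by simpa using hm)])
    (annih_mem_siteAlg q rfl)

theorem creA_mem : creA q κ i ∈ siteAlg q {i} :=
  mul_mem (creat_mem_siteAlg q rfl)
    (qPow_mem_siteAlg q fun s m hm => by rw [numB_up_of_ne (by simpa using hm)])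

theorem creB_mem : creB q κ i ∈ siteAlg q {i} :=
  mul_mem (creat_mem_siteAlg q rfl)
    (qPow_mem_siteAlg q fun s m hm => by rw [numA_up_of_ne (by simpa using hm)])

end Membership

/-! ### Spinors, dressed fluxes and their local exchange relations. -/

/-- The spinor `t^ε` with raised index, `(-1)^{1/2 + ε A} q^{A/2} t^ε_{-A}`. -/
def uSpinor (q : ℝ) (i : Fin n) (ε : Bool) (A : Fin 2) : Op n :=
  (spinSign ε A * q ^ (mag A / 2)) • tSpinor q i ε A.rev

theorem smul_creat_mul_qPow {q : ℝ} (hq : 0 < q) (r : ℝ) (m : Fin n × Fin 2) (f : Occ n → ℝ) :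
    q ^ r • (creat q m * qPow q f) = creat q m * qPow q fun s => r + f s := by
  rw [← mul_smul_comm, smul_qPow hq]

section Spinors

variable {q : ℝ}

theorem uSpinor_false_zero (i : Fin n) :
    uSpinor q i false 0 = -(q ^ (-1 / 4 : ℝ) • annB q 1 i) := by
  have : (-1 / 2 / 2 : ℝ) = -1 / 4 := by norm_num
  simp [uSpinor, spinSign, mag, tSpinor, annB, this, neg_smul]

theorem uSpinor_false_one (i : Fin n) : uSpinor q i false 1 = q ^ (1 / 4 : ℝ) • annA q 1 i := by
  have : (2⁻¹ / 2 : ℝ) = 4⁻¹ := by norm_num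
  simp [uSpinor, spinSign, mag, tSpinor, annA, this]

/-- The index-raising factor `q^{-1/4}` cancels the shift in `q^{(N_b+1)/4}`, leaving no scalar. -/
theorem uSpinor_true_zero (hq : 0 < q) (i : Fin n) : uSpinor q i true 0 = creA q 1 i := by
  have h : uSpinor q i true 0 =
      q ^ (-1 / 4 : ℝ) • (creat q (i, 0) * qPow q fun s => (numB i s + 1) / 4) := by
    have : (-1 / 2 / 2 : ℝ) = -1 / 4 := by norm_num
    simp [uSpinor, spinSign, mag, tSpinor, this]
  rw [h, smul_creat_mul_qPow hq, creA]
  congr 2; funext s; ring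

theorem uSpinor_true_one (hq : 0 < q) (i : Fin n) : uSpinor q i true 1 = creB q 1 i := by
  have h : uSpinor q i true 1 =
      q ^ (1 / 4 : ℝ) • (creat q (i, 1) * qPow q fun s => -(numA i s + 1) / 4) := by
    have h0 : Fin.rev (1 : Fin 2) = 0 := rfl
    simp [uSpinor, spinSign, mag, tSpinor, h0, neg_smul, smul_neg, neg_neg]
    norm_num
  rw [h, smul_creat_mul_qPow hq, creB]
  congr 2; funext s; ring

theorem tauSpinor_false_zero (i : Fin n) : tauSpinor q i false 0 = annA q (-1) i := by
  simp [tauSpinor, annA]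

theorem tauSpinor_false_one (i : Fin n) : tauSpinor q i false 1 = annB q (-1) i := by
  simp [tauSpinor, annB]

theorem tauSpinor_true_zero (hq : 0 < q) (i : Fin n) :
    tauSpinor q i true 0 = -(q ^ (1 / 4 : ℝ) • creB q (-1) i) := by
  rw [creB, smul_creat_mul_qPow hq]
  simp only [tauSpinor, Matrix.cons_val_zero]
  congr 3; funext s; ring

theorem tauSpinor_true_one (hq : 0 < q) (i : Fin n) :
    tauSpinor q i true 1 = q ^ (-1 / 4 : ℝ) • creA q (-1) i := by
  rw [creA, smul_creat_mul_qPow hq]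
  simp only [tauSpinor, Matrix.cons_val_one, Matrix.cons_val_zero]
  congr 2; funext s; ring

theorem uSpinor_mem (hq : 0 < q) (i : Fin n) (ε : Bool) (A : Fin 2) :
    uSpinor q i ε A ∈ siteAlg q {i} := by
  cases ε <;> fin_cases A <;> simp only [Fin.zero_eta, Fin.mk_one]
  · rw [uSpinor_false_zero]; exact neg_mem (Subalgebra.smul_mem _ (annB_mem q 1 i) _)
  · rw [uSpinor_false_one]; exact Subalgebra.smul_mem _ (annA_mem q 1 i) _
  · rw [uSpinor_true_zero hq]; exact creA_mem q 1 i
  · rw [uSpinor_true_one hq]; exact creB_mem q 1 i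

theorem tauSpinor_mem (hq : 0 < q) (i : Fin n) (ε : Bool) (A : Fin 2) :
    tauSpinor q i ε A ∈ siteAlg q {i} := by
  cases ε <;> fin_cases A <;> simp only [Fin.zero_eta, Fin.mk_one]
  · rw [tauSpinor_false_zero]; exact annA_mem q _ i
  · rw [tauSpinor_false_one]; exact annB_mem q _ i
  · rw [tauSpinor_true_zero hq]; exact neg_mem (Subalgebra.smul_mem _ (creB_mem q _ i) _)
  · rw [tauSpinor_true_one hq]; exact Subalgebra.smul_mem _ (creA_mem q _ i) _

end Spinors

/-- The sign `±` as a real number. -/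
def sgn (ε : Bool) : ℝ := if ε then 1 else -1

/-- The flux at the edge `k` with the factor `q^{± N_k / 4}` absorbed. -/
def wMat (q : ℝ) (ε : Bool) (k : Fin n) : Matrix (Fin 2) (Fin 2) (Op n) := fun A B =>
  qPow q (fun s => sgn ε * num k s / 4) * flux q k A B

section Entries

variable {q : ℝ}

theorem wMat_zero_zero (hq : 0 < q) (ε : Bool) (k : Fin n) :
    wMat q ε k 0 0 = qPow q fun s => sgn ε * num k s / 4 - (numA k s - numB k s) / 4 := by
  simp only [wMat, flux, Matrix.of_apply, Matrix.cons_val', Matrix.cons_val_zero]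
  rw [qPow_mul hq]
  congr 1; funext s; ring

theorem wMat_one_one (hq : 0 < q) (ε : Bool) (k : Fin n) :
    wMat q ε k 1 1 = qPow q fun s => sgn ε * num k s / 4 + (numA k s - numB k s) / 4 := by
  simp only [wMat, flux, Matrix.of_apply, Matrix.cons_val', Matrix.cons_val_one, Matrix.cons_val_zero]
  rw [qPow_mul hq]

theorem wMat_one_zero (ε : Bool) (k : Fin n) : wMat q ε k 1 0 = 0 := by
  simp [wMat, flux]

theorem wMat_zero_one (ε : Bool) (k : Fin n) :
    wMat q ε k 0 1 = -((q ^ (1 / 4 : ℝ) * (q ^ (1 / 2 : ℝ) - q ^ (-1 / 2 : ℝ))) •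
      (creat q (k, 1) * qPow q (fun s => sgn ε * (num k s + 1) / 4) * annih q (k, 0))) := by
  simp only [wMat, flux, Matrix.of_apply, Matrix.cons_val', Matrix.cons_val_zero,
    Matrix.cons_val_one]
  rw [mul_neg, mul_smul_comm, (commute_annih_creat q (modes_ne k)).eq, ← mul_assoc,
    qPow_mul_creat]
  simp only [num, numA_up', numB_up, add_assoc]

theorem wMat_true (hq : 0 < q) (k : Fin n) (A B : Fin 2) :
    wMat q true k A B = qPow q (fun s => num k s / 2) * wMat q false k A B := by
  rw [wMat, wMat, ← mul_assoc, qPow_mul hq]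
  congr 2; funext s; simp only [sgn]; norm_num; ring

theorem wMat_false (hq : 0 < q) (k : Fin n) (A B : Fin 2) :
    wMat q false k A B = qPow q (fun s => -num k s / 2) * wMat q true k A B := by
  rw [wMat, wMat, ← mul_assoc, qPow_mul hq]
  congr 2; funext s; simp only [sgn]; norm_num; ring

theorem flux_mem (k : Fin n) (A B : Fin 2) : flux q k A B ∈ siteAlg q {k} := by
  have h : ∀ f : ℝ → ℝ → ℝ, qPow q (fun s => f (numA k s) (numB k s)) ∈ siteAlg q {k} := fun f =>
    qPow_mem_siteAlg q fun s m hm => by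
      rw [numA_up_of_ne (by simpa using hm), numB_up_of_ne (by simpa using hm)]
  fin_cases A <;> fin_cases B <;> simp only [Fin.zero_eta, Fin.mk_one, flux, Matrix.of_apply,
    Matrix.cons_val', Matrix.cons_val_one, Matrix.cons_val_zero]
  · exact h fun x y => -(x - y) / 4
  · have h1 : annih q (k, 0) ∈ siteAlg q {k} := annih_mem_siteAlg q (Set.mem_singleton k)
    have h2 : creat q (k, 1) ∈ siteAlg q {k} := creat_mem_siteAlg q (Set.mem_singleton k)
    exact neg_mem (Subalgebra.smul_mem _ (mul_mem h1 h2) _)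
  · exact zero_mem (siteAlg q {k})
  · exact h fun x y => (x - y) / 4

theorem wMat_mem (ε : Bool) (k : Fin n) (A B : Fin 2) : wMat q ε k A B ∈ siteAlg q {k} :=
  mul_mem (qPow_mem_siteAlg q fun s m hm => by
      rw [num, num, numA_up_of_ne (by simpa using hm), numB_up_of_ne (by simpa using hm)])
    (flux_mem k A B)

end Entries

/-- The dressings of τ and t cancel on the diagonal, where `[x+1] - q^{1/2}[x] = q^{-x/2}` gives the
diagonal flux entries. Off the diagonal, reordering produces `q^{-1/2}` in one entry and `q^{1/2}`
in the other: the first leaves the factor `q^{-1/2} - q^{1/2}`, the second cancels, whence the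
triangular shape of the flux. -/
theorem tau_mul_u {q : ℝ} (hq : 0 < q) (k : Fin n) (A B : Fin 2) :
    tauSpinor q k false A * uSpinor q k true B
      - q ^ (1 / 2 : ℝ) • (uSpinor q k true B * tauSpinor q k false A) = wMat q false k A B := by
  have e : (q ^ ((-1 - 1) / 4 : ℝ) - q ^ (1 / 2 : ℝ) : ℝ) =
      -(q ^ (1 / 2 : ℝ) - q ^ (-1 / 2 : ℝ)) := by norm_num
  fin_cases A <;> fin_cases B <;> simp only [Fin.zero_eta, Fin.mk_one] <;>
    simp -failIfUnchanged only [tauSpinor_false_zero, tauSpinor_false_one, uSpinor_true_zero hq,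
      uSpinor_true_one hq]
  · rw [annA_mul_creA hq, creA_mul_annA hq, smul_diagOp, diagOp_sub, wMat_zero_zero hq, qPow]
    congr 1; funext s
    rw [qInt_add_one hq, show (-1 + 1) * numB k s / 4 = 0 by ring, Real.rpow_zero,
      show sgn false * num k s / 4 - (numA k s - numB k s) / 4 = -numA k s / 2 by
        simp only [sgn, num]; norm_num; ring]
    ring
  · rw [annA_mul_creB hq, creB_mul_annA hq, ← sub_smul, e, neg_smul, wMat_zero_one]
    -- The `q^{1/4}` in the flux compensates the shift `N + 1` caused by normal ordering `a b†` in
    -- `wMat_zero_one`.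
    have h0 : (creat q (k, 1) * qPow q (fun s => (-1 * numB k s - 1 * numA k s) / 4) *
        annih q (k, 0)) = q ^ (1 / 4 : ℝ) •
        (creat q (k, 1) * qPow q (fun s => sgn false * (num k s + 1) / 4) * annih q (k, 0)) := by
      rw [← smul_mul_assoc, ← mul_smul_comm, smul_qPow hq]
      congr 3; funext s
      simp only [sgn, num]; norm_num; ring
    rw [h0, smul_smul, mul_comm]
  · rw [annB_mul_creA hq, ← sub_smul, wMat_one_zero]
    norm_num
  · rw [annB_mul_creB hq, creB_mul_annB hq, smul_diagOp, diagOp_sub, wMat_one_one hq, qPow]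
    congr 1; funext s
    rw [qInt_add_one hq, show -(-1 + 1) * numA k s / 4 = 0 by ring, Real.rpow_zero,
      show sgn false * num k s / 4 + (numA k s - numB k s) / 4 = -numB k s / 2 by
        simp only [sgn, num]; norm_num; ring]
    ring

/-- The mirror computation, with `[x+1] - q^{-1/2}[x] = q^{x/2}` on the diagonal; the same flux
appears with the opposite dressing. -/
theorem u_mul_tau {q : ℝ} (hq : 0 < q) (k : Fin n) (A B : Fin 2) :
    uSpinor q k false B * tauSpinor q k true A
      - q ^ (-1 / 2 : ℝ) • (tauSpinor q k true A * uSpinor q k false B) = wMat q true k A B := by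
  have e1 : q ^ (-1 / 4 : ℝ) * q ^ (1 / 4 : ℝ) = 1 := by
    rw [← Real.rpow_add hq]; norm_num
  have e2 : q ^ (1 / 4 : ℝ) * q ^ (-1 / 4 : ℝ) = 1 := by
    rw [← Real.rpow_add hq]; norm_num
  fin_cases A <;> fin_cases B <;> simp only [Fin.zero_eta, Fin.mk_one] <;>
    simp -failIfUnchanged only [tauSpinor_true_zero hq, tauSpinor_true_one hq, uSpinor_false_zero,
      uSpinor_false_one, neg_mul, mul_neg, smul_mul_smul_comm, neg_neg, e1, e2,
      one_smul]
  · rw [annB_mul_creB hq, creB_mul_annB hq, smul_diagOp, diagOp_sub, wMat_zero_zero hq, qPow]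
    congr 1; funext s
    rw [qInt_add_one' hq, show -(1 + -1) * numA k s / 4 = 0 by ring, Real.rpow_zero,
      show sgn true * num k s / 4 - (numA k s - numB k s) / 4 = numB k s / 2 by
        simp only [sgn, num]; norm_num; ring]
    ring
  · rw [annA_mul_creB hq, creB_mul_annA hq, wMat_zero_one]
    have e5 : (q ^ ((1 - -1) / 4 : ℝ) : ℝ) = q ^ (1 / 2 : ℝ) := by norm_num
    have h0 : (creat q (k, 1) * qPow q (fun s => sgn true * (num k s + 1) / 4) * annih q (k, 0)) =
      q ^ (1 / 4 : ℝ) • (creat q (k, 1) * (qPow q fun s => (1 * numB k s - -1 * numA k s) / 4) *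
        annih q (k, 0)) := by
      rw [← smul_mul_assoc, ← mul_smul_comm, smul_qPow hq]
      congr 3; funext s
      simp only [sgn, num]; norm_num; ring
    rw [h0, e5]
    generalize creat q (k, 1) * (qPow q fun s => (1 * numB k s - -1 * numA k s) / 4) *
        annih q (k, 0) = X
    module
  · rw [annB_mul_creA hq, wMat_one_zero, show ((-1 - 1) / 4 : ℝ) = -1 / 2 by norm_num]
    module
  · rw [annA_mul_creA hq, creA_mul_annA hq, smul_diagOp, diagOp_sub, wMat_one_one hq, qPow]
    congr 1; funext s
    rw [qInt_add_one' hq, show (1 + -1) * numB k s / 4 = 0 by ring, Real.rpow_zero,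
      show sgn true * num k s / 4 + (numA k s - numB k s) / 4 = numA k s / 2 by
        simp only [sgn, num]; norm_num; ring]
    ring

/-- The opposite dressings of τ and t make the reordering factor `q^{(κ+l)/4}` trivial. -/
theorem commute_tau_u_false {q : ℝ} (hq : 0 < q) (k : Fin n) (A B : Fin 2) :
    Commute (tauSpinor q k false A) (uSpinor q k false B) := by
  have h1 := annB_mul_annA hq (-1) 1 k
  have h2 := annB_mul_annA hq 1 (-1) k
  norm_num at h1 h2
  fin_cases A <;> fin_cases B <;> simp only [Fin.zero_eta, Fin.mk_one] <;>
    simp -failIfUnchanged only [tauSpinor_false_zero, tauSpinor_false_one, uSpinor_false_zero,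
      uSpinor_false_one]
  · exact (Commute.smul_right h1.symm _).neg_right
  · exact Commute.smul_right (commute_annA _ _ _ _) _
  · exact (Commute.smul_right (commute_annB _ _ _ _) _).neg_right
  · exact (Commute.smul_right h2 _)

theorem commute_tau_u_true {q : ℝ} (hq : 0 < q) (k : Fin n) (A B : Fin 2) :
    Commute (tauSpinor q k true A) (uSpinor q k true B) := by
  have h1 := creA_mul_creB hq (-1) 1 k
  have h2 := creA_mul_creB hq 1 (-1) k
  norm_num at h1 h2
  fin_cases A <;> fin_cases B <;> simp only [Fin.zero_eta, Fin.mk_one] <;>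
    simp -failIfUnchanged only [tauSpinor_true_zero hq, tauSpinor_true_one hq, uSpinor_true_zero hq,
      uSpinor_true_one hq]
  · exact (Commute.smul_left h1.symm _).neg_left
  · exact (Commute.smul_left (commute_creB _ _ _ _) _).neg_left
  · exact (Commute.smul_left (commute_creA _ _ _ _) _)
  · exact (Commute.smul_left h2 _)

/-! ### Ordered products of fluxes along a chain. -/

/-- The edges strictly between `i` and `j`, in increasing order. -/
def between (i j : Fin n) : List (Fin n) := (List.finRange n).filter fun k => i < k ∧ k < j

theorem mem_between {i j k : Fin n} : k ∈ between i j ↔ i < k ∧ k < j := by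
  simp [between]

theorem pairwise_between (i j : Fin n) : (between i j).Pairwise (· < ·) :=
  (List.pairwise_lt_finRange n).filter _

/-- Reduces splitting a chain at its first or last inner edge to a membership check. -/
theorem eq_of_pairwise_lt {l l' : List (Fin n)} (h : l.Pairwise (· < ·)) (h' : l'.Pairwise (· < ·))
    (hm : ∀ k, k ∈ l ↔ k ∈ l') : l = l' := by
  have hp : l.Perm l' :=
    (List.perm_ext_iff_of_nodup (h.imp fun h => h.ne) (h'.imp fun h => h.ne)).2 hm
  exact hp.eq_of_pairwise (fun a b _ _ h1 h2 => absurd h2 (not_lt.2 h1.le)) h h'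

theorem between_succ {i k j : Fin n} (hik : i < k) (hkj : (k : ℕ) + 1 = j) :
    between i j = between i k ++ [k] := by
  refine eq_of_pairwise_lt (pairwise_between i j) ?_ ?_
  · rw [List.pairwise_append]
    refine ⟨pairwise_between i k, List.pairwise_singleton _ _, ?_⟩
    intro a ha b hb
    rw [List.mem_singleton.1 hb]
    exact (mem_between.1 ha).2
  · intro l
    simp only [List.mem_append, mem_between, List.mem_singleton, Fin.lt_def, Fin.ext_iff] at *
    omega

theorem between_cons {i k j : Fin n} (hik : (i : ℕ) + 1 = k) (hkj : k < j) :
    between i j = k :: between k j := by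
  refine eq_of_pairwise_lt (pairwise_between i j) ?_ ?_
  · rw [List.pairwise_cons]
    exact ⟨fun a ha => (mem_between.1 ha).1, pairwise_between k j⟩
  · intro l
    simp only [List.mem_cons, mem_between, Fin.lt_def, Fin.ext_iff] at *
    omega

theorem between_adjacent {i j : Fin n} (h : (i : ℕ) + 1 = j) : between i j = [] := by
  refine List.eq_nil_iff_forall_not_mem.2 fun k hk => ?_
  have := mem_between.1 hk
  simp only [Fin.lt_def] at this
  omega

theorem sum_between (i j : Fin n) (f : Fin n → ℝ) :
    ∑ k ∈ Finset.Ioo i j, f k = ((between i j).map f).sum := by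
  have h : Finset.Ioo i j = (between i j).toFinset := by
    ext k; simp [mem_between]
  rw [h, List.sum_toFinset _ ((pairwise_between i j).imp fun h => h.ne)]

/-- The ordered product of the rescaled fluxes along a list of edges. -/
def wProd (q : ℝ) (ε : Bool) (l : List (Fin n)) : Matrix (Fin 2) (Fin 2) (Op n) :=
  (l.map (wMat q ε)).prod

/-- Flux entries only move a boson from `a` to `b` at the same edge, so they commute with functions
that do not see which of the two modes is occupied, in particular with functions of the totals
`N_l`. -/
theorem commute_diagOp_flux (q : ℝ) (k : Fin n) {c : Occ n → ℝ}
    (h : ∀ s, c (up s (k, 0)) = c (up s (k, 1))) (A B : Fin 2) :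
    Commute (diagOp c) (flux q k A B) := by
  fin_cases A <;> fin_cases B <;> simp only [Fin.zero_eta, Fin.mk_one, flux, Matrix.of_apply,
    Matrix.cons_val', Matrix.cons_val_one, Matrix.cons_val_zero]
  · exact commute_diagOp _ _
  · refine (Commute.smul_right ?_ _).neg_right
    rw [(commute_annih_creat q (modes_ne k)).eq, Commute, SemiconjBy, ← mul_assoc,
      diagOp_mul_creat, mul_assoc, mul_assoc, annih_mul_diagOp]
    simp only [h]
  · exact Commute.zero_right _
  · exact commute_diagOp _ _

theorem num_up_eq (k l : Fin n) (s : Occ n) : num k (up s (l, 0)) = num k (up s (l, 1)) := by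
  by_cases h : l = k
  · subst h
    simp only [num, numA_up, numB_up, numA_up', numB_up']
    ring
  · simp only [num, numA_up_of_ne h, numB_up_of_ne h]

theorem num_up_of_ne {i : Fin n} {m : Fin n × Fin 2} (h : m.1 ≠ i) (s : Occ n) :
    num i (up s m) = num i s := by
  obtain ⟨j, x⟩ := m
  simp only [num, numA_up_of_ne h, numB_up_of_ne h]

/-- The powers of `q` attached to the single edges can be collected in front because fluxes conserve
every `N_k`. -/
theorem wProd_apply {q : ℝ} (hq : 0 < q) (ε : Bool) (l : List (Fin n)) (A B : Fin 2) :
    wProd q ε l A B = qPow q (fun s => sgn ε * (l.map fun k => num k s).sum / 4) *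
      (l.map fun k => flux q k).prod A B := by
  induction l generalizing A with
  | nil => simp [wProd, qPow_zero]
  | cons k l ih =>
    have hc : ∀ C, Commute (qPow q fun s => sgn ε * (l.map fun k => num k s).sum / 4)
        (flux q k A C) := fun C =>
      commute_diagOp_flux q k (fun s => by simp only [num_up_eq]) A C
    have hl : wProd q ε (k :: l) = wMat q ε k * wProd q ε l := by
      simp [wProd]
    rw [hl, List.map_cons, List.prod_cons, Matrix.mul_apply, Matrix.mul_apply, Finset.mul_sum]
    refine Finset.sum_congr rfl fun C _ => ?_
    rw [ih, wMat, mul_assoc, ← mul_assoc (flux q k A C), ← (hc C).eq, mul_assoc, ← mul_assoc,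
      qPow_mul hq]
    congr 2; funext s
    simp only [List.map_cons, List.sum_cons]
    ring

theorem wProd_mem (q : ℝ) (ε : Bool) (l : List (Fin n)) {S : Set (Fin n)} (h : ∀ k ∈ l, k ∈ S)
    (A B : Fin 2) : wProd q ε l A B ∈ siteAlg q S := by
  induction l generalizing A with
  | nil =>
    simp only [wProd, List.map_nil, List.prod_nil, Matrix.one_apply]
    split_ifs
    · exact one_mem _
    · exact zero_mem _
  | cons k l ih =>
    have hl : wProd q ε (k :: l) = wMat q ε k * wProd q ε l := by
      simp [wProd]
    rw [hl, Matrix.mul_apply]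
    refine sum_mem fun C _ => mul_mem ?_ (ih (fun a ha => h a (by simp [ha])) C)
    exact siteAlg_mono q (by simpa using h k (by simp)) (wMat_mem ε k A C)

theorem obs_eq_sum {q : ℝ} (hq : 0 < q) (ε ε' : Bool) (i j : Fin n) :
    obs q ε ε' i j = ∑ A, ∑ B,
      uSpinor q i ε A * wProd q ε (between i j) A B * tauSpinor q j ε' B := by
  unfold obs
  rw [Finset.mul_sum]
  refine Finset.sum_congr rfl fun A _ => ?_
  rw [Finset.mul_sum]
  refine Finset.sum_congr rfl fun B _ => ?_
  have h1 : qPow q (fun s => (if ε then 1 else -1) * (∑ k ∈ Finset.Ioo i j, num k s) / 4) =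
      qPow q (fun s => sgn ε * ((between i j).map fun k => num k s).sum / 4) := by
    congr 1; funext s
    rw [sum_between]; rfl
  -- The prefactor does not involve the edge `i`, so it can pass the spinor there and be absorbed
  -- into the fluxes.
  have h2 : qPow q (fun s => sgn ε * ((between i j).map fun k => num k s).sum / 4) ∈
      siteAlg q {k | k ≠ i} := by
    refine qPow_mem_siteAlg q fun s m hm => ?_
    have hi : m.1 = i := by simpa using hm
    congr 3
    refine List.map_congr_left fun k hk => num_up_of_ne ?_ s
    rw [hi]; exact (mem_between.1 hk).1.ne
  have h3 := commute_of_mem_siteAlg (by simp) h2 (uSpinor_mem hq i ε A)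
  have h4 : transport q i j = ((between i j).map fun k => flux q k).prod := rfl
  rw [h1, wProd_apply hq, h4, ← smul_mul_assoc, ← smul_mul_assoc, ← mul_assoc, ← mul_assoc,
    ← mul_assoc, ← h3.eq]
  rfl

/-! ### Exchange at a shared edge and the recursion relations. -/

/-- The row spinor obtained by transporting `uSpinor` from the edge `i` to the edge `k`. -/
def row (q : ℝ) (ε : Bool) (i k : Fin n) (B : Fin 2) : Op n :=
  ∑ A, uSpinor q i ε A * wProd q ε (between i k) A B

/-- The column spinor obtained by transporting `tauSpinor` from the edge `j` to the edge `k`. -/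
def col (q : ℝ) (ε ε' : Bool) (k j : Fin n) (A : Fin 2) : Op n :=
  ∑ B, wProd q ε (between k j) A B * tauSpinor q j ε' B

section RowCol

variable {q : ℝ}

theorem obs_eq_row (hq : 0 < q) (ε ε' : Bool) (i j : Fin n) :
    obs q ε ε' i j = ∑ B, row q ε i j B * tauSpinor q j ε' B := by
  rw [obs_eq_sum hq, Finset.sum_comm]
  simp only [row, Finset.sum_mul]

theorem obs_eq_col (hq : 0 < q) (ε ε' : Bool) (i j : Fin n) :
    obs q ε ε' i j = ∑ A, uSpinor q i ε A * col q ε ε' i j A := by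
  rw [obs_eq_sum hq]
  simp only [col, Finset.mul_sum, mul_assoc]

theorem row_adjacent (ε : Bool) {i k : Fin n} (h : (i : ℕ) + 1 = k) (B : Fin 2) :
    row q ε i k B = uSpinor q i ε B := by
  simp [row, between_adjacent h, wProd, Matrix.one_apply]

theorem col_adjacent (ε ε' : Bool) {k j : Fin n} (h : (k : ℕ) + 1 = j) (A : Fin 2) :
    col q ε ε' k j A = tauSpinor q j ε' A := by
  simp [col, between_adjacent h, wProd, Matrix.one_apply]

theorem row_succ (ε : Bool) {i k j : Fin n} (hik : i < k) (hkj : (k : ℕ) + 1 = j) (B : Fin 2) :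
    row q ε i j B = ∑ A, row q ε i k A * wMat q ε k A B := by
  have h : wProd q ε (between i j) = wProd q ε (between i k) * wMat q ε k := by
    simp [wProd, between_succ hik hkj]
  simp only [row, h, Matrix.mul_apply, Finset.mul_sum, Finset.sum_mul, mul_assoc]
  rw [Finset.sum_comm]

theorem col_succ (ε ε' : Bool) {i k j : Fin n} (hik : (i : ℕ) + 1 = k) (hkj : k < j) (A : Fin 2) :
    col q ε ε' i j A = ∑ B, wMat q ε k A B * col q ε ε' k j B := by
  have h : wProd q ε (between i j) = wMat q ε k * wProd q ε (between k j) := by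
    simp [wProd, between_cons hik hkj]
  simp only [col, h, Matrix.mul_apply, Finset.mul_sum, Finset.sum_mul, mul_assoc]
  rw [Finset.sum_comm]

theorem row_mem (hq : 0 < q) (ε : Bool) {i k : Fin n} (h : i < k) (B : Fin 2) :
    row q ε i k B ∈ siteAlg q (Set.Iio k) := by
  refine sum_mem fun A _ => mul_mem (siteAlg_mono q (by simpa using h) (uSpinor_mem hq i ε A)) ?_
  exact wProd_mem q ε _ (fun l hl => (mem_between.1 hl).2) A B

theorem col_mem (hq : 0 < q) (ε ε' : Bool) {k j : Fin n} (h : k < j) (A : Fin 2) :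
    col q ε ε' k j A ∈ siteAlg q (Set.Ioi k) := by
  refine sum_mem fun B _ => mul_mem ?_ (siteAlg_mono q (by simpa using h) (tauSpinor_mem hq j ε' B))
  exact wProd_mem q ε _ (fun l hl => (mem_between.1 hl).1) A B

end RowCol

/-- Here `r` lives to the left of the shared edge, `c` to its right, and `x`, `y` on it. Moving `r`
and `c` outwards leaves only the order of `x` and `y` to distinguish the two products. -/
theorem sum_exchange {R : Type*} [Ring R] [Algebra ℝ R] {r x y c : Fin 2 → R}
    (hry : ∀ A B, Commute (r A) (y B)) (hrc : ∀ A B, Commute (r A) (c B))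
    (hxc : ∀ A B, Commute (x A) (c B)) (t : ℝ) :
    (∑ A, r A * x A) * (∑ B, y B * c B) - t • ((∑ B, y B * c B) * (∑ A, r A * x A)) =
        ∑ A, ∑ B, r A * (x A * y B - t • (y B * x A)) * c B ∧
    (∑ B, y B * c B) * (∑ A, r A * x A) - t • ((∑ A, r A * x A) * (∑ B, y B * c B)) =
        ∑ A, ∑ B, r A * (y B * x A - t • (x A * y B)) * c B := by
  have h1 : (∑ A, r A * x A) * (∑ B, y B * c B) = ∑ A, ∑ B, r A * (x A * y B) * c B := by
    simp only [Finset.sum_mul_sum, mul_assoc]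
  have h2 : (∑ B, y B * c B) * (∑ A, r A * x A) = ∑ A, ∑ B, r A * (y B * x A) * c B := by
    rw [Finset.sum_mul_sum, Finset.sum_comm]
    refine Finset.sum_congr rfl fun A _ => Finset.sum_congr rfl fun B _ => ?_
    rw [mul_assoc, ← mul_assoc (c B), ← (hrc A B).eq, mul_assoc (r A), ← (hxc A B).eq,
      ← mul_assoc, ← mul_assoc, ← (hry A B).eq, ← mul_assoc]
  rw [h1, h2]
  simp only [Finset.smul_sum, ← Finset.sum_sub_distrib, mul_sub, sub_mul, mul_smul_comm,
    smul_mul_assoc, and_self]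

section Exchange

variable {q : ℝ}

theorem disjoint_Iio_singleton (k : Fin n) : Disjoint (Set.Iio k) {k} := by simp

theorem disjoint_singleton_Ioi (k : Fin n) : Disjoint {k} (Set.Ioi k) := by simp

theorem disjoint_Iio_Ioi (k : Fin n) : Disjoint (Set.Iio k) (Set.Ioi k) :=
  Set.disjoint_left.2 fun _ h1 h2 => lt_asymm (Set.mem_Iio.1 h1) (Set.mem_Ioi.1 h2)

theorem obs_exchange (hq : 0 < q) (ε ε₁ ε₂ ε' : Bool) {i k j : Fin n} (hik : i < k) (hkj : k < j)
    (t : ℝ) :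
    obs q ε ε₁ i k * obs q ε₂ ε' k j - t • (obs q ε₂ ε' k j * obs q ε ε₁ i k) =
      ∑ A, ∑ B, row q ε i k A * (tauSpinor q k ε₁ A * uSpinor q k ε₂ B
        - t • (uSpinor q k ε₂ B * tauSpinor q k ε₁ A)) * col q ε₂ ε' k j B ∧
    obs q ε₂ ε' k j * obs q ε ε₁ i k - t • (obs q ε ε₁ i k * obs q ε₂ ε' k j) =
      ∑ A, ∑ B, row q ε i k A * (uSpinor q k ε₂ B * tauSpinor q k ε₁ A
        - t • (tauSpinor q k ε₁ A * uSpinor q k ε₂ B)) * col q ε₂ ε' k j B := by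
  rw [obs_eq_row hq ε ε₁ i k, obs_eq_col hq ε₂ ε' k j]
  refine sum_exchange (fun A B => ?_) (fun A B => ?_) (fun A B => ?_) t
  · exact commute_of_mem_siteAlg (disjoint_Iio_singleton k) (row_mem hq ε hik A)
      (uSpinor_mem hq k ε₂ B)
  · exact commute_of_mem_siteAlg (disjoint_Iio_Ioi k) (row_mem hq ε hik A)
      (col_mem hq ε₂ ε' hkj B)
  · exact commute_of_mem_siteAlg (disjoint_singleton_Ioi k) (tauSpinor_mem hq k ε₁ A)
      (col_mem hq ε₂ ε' hkj B)

theorem obs_mul_obs_true (hq : 0 < q) (ε ε' : Bool) {i k j : Fin n} (hik : i < k) (hkj : k < j) :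
    obs q ε false i k * obs q true ε' k j
      - q ^ (1 / 2 : ℝ) • (obs q true ε' k j * obs q ε false i k) =
    ∑ A, ∑ B, row q ε i k A * wMat q false k A B * col q true ε' k j B := by
  rw [(obs_exchange hq ε false true ε' hik hkj _).1]
  simp only [tau_mul_u hq]

theorem obs_false_mul_obs (hq : 0 < q) (ε ε' : Bool) {i k j : Fin n} (hik : i < k) (hkj : k < j) :
    obs q false ε' k j * obs q ε true i k
      - q ^ (-1 / 2 : ℝ) • (obs q ε true i k * obs q false ε' k j) =
    ∑ A, ∑ B, row q ε i k A * wMat q true k A B * col q false ε' k j B := by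
  rw [(obs_exchange hq ε true false ε' hik hkj _).2]
  simp only [u_mul_tau hq]

theorem commute_obs_chain (hq : 0 < q) (ε ε₁ ε' : Bool) {i k j : Fin n} (hik : i < k)
    (hkj : k < j) : Commute (obs q ε ε₁ i k) (obs q ε₁ ε' k j) := by
  have h := (obs_exchange hq ε ε₁ ε₁ ε' hik hkj 1).1
  have h0 : ∀ A B, tauSpinor q k ε₁ A * uSpinor q k ε₁ B
        - (1 : ℝ) • (uSpinor q k ε₁ B * tauSpinor q k ε₁ A) = 0 := by
    intro A B
    rw [one_smul, sub_eq_zero]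
    cases ε₁
    · exact commute_tau_u_false hq k A B
    · exact commute_tau_u_true hq k A B
  simp only [h0, mul_zero, zero_mul, Finset.sum_const_zero] at h
  rwa [one_smul, sub_eq_zero] at h

/-- The sign `ε₂` is free because `k` and `j` are adjacent: the column contains no fluxes, only τ.
-/
theorem sum_row_right (hq : 0 < q) (ε ε₂ ε' : Bool) {i k j : Fin n} (hik : i < k)
    (hkj : (k : ℕ) + 1 = j) :
    ∑ A, ∑ B, row q ε i k A * wMat q ε k A B * col q ε₂ ε' k j B = obs q ε ε' i j := by
  rw [obs_eq_row hq, Finset.sum_comm]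
  simp only [row_succ ε hik hkj, col_adjacent ε₂ ε' hkj, Finset.sum_mul]

theorem sum_row_left (hq : 0 < q) (ε ε' : Bool) {i k j : Fin n} (hik : (i : ℕ) + 1 = k)
    (hkj : k < j) :
    ∑ A, ∑ B, row q ε i k A * wMat q ε k A B * col q ε ε' k j B = obs q ε ε' i j := by
  rw [obs_eq_col hq]
  simp only [row_adjacent ε hik, col_succ ε ε' hik hkj, Finset.mul_sum, mul_assoc]

theorem sum_row_smul (hq : 0 < q) (ε ε₁ ε₂ ε' : Bool) {i k j : Fin n} (hik : i < k) (t : ℝ) :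
    ∑ A, ∑ B, row q ε i k A * (qPow q (fun s => t * num k s) * wMat q ε₁ k A B) *
        col q ε₂ ε' k j B = qPow q (fun s => t * num k s) *
      ∑ A, ∑ B, row q ε i k A * wMat q ε₁ k A B * col q ε₂ ε' k j B := by
  rw [Finset.mul_sum]
  refine Finset.sum_congr rfl fun A _ => ?_
  rw [Finset.mul_sum]
  refine Finset.sum_congr rfl fun B _ => ?_
  have h1 : qPow q (fun s => t * num k s) ∈ siteAlg q {k} :=
    qPow_mem_siteAlg q fun s m hm => by rw [num_up_of_ne (by simpa using hm)]
  have h2 := commute_of_mem_siteAlg (disjoint_Iio_singleton k) (row_mem hq ε hik A) h1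
  rw [← mul_assoc, h2.eq]
  simp only [mul_assoc]

theorem sum_row_true (hq : 0 < q) (ε ε₂ ε' : Bool) {i k j : Fin n} (hik : i < k) :
    ∑ A, ∑ B, row q ε i k A * wMat q true k A B * col q ε₂ ε' k j B =
      qPow q (fun s => num k s / 2) *
      ∑ A, ∑ B, row q ε i k A * wMat q false k A B * col q ε₂ ε' k j B := by
  have h : (fun s : Occ n => num k s / 2) = fun s => (1 / 2) * num k s := by
    funext s; ring
  rw [h, ← sum_row_smul hq ε false ε₂ ε' hik, ← h]
  simp only [← wMat_true hq]

theorem sum_row_false (hq : 0 < q) (ε ε₂ ε' : Bool) {i k j : Fin n} (hik : i < k) :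
    ∑ A, ∑ B, row q ε i k A * wMat q false k A B * col q ε₂ ε' k j B =
      qPow q (fun s => -num k s / 2) *
      ∑ A, ∑ B, row q ε i k A * wMat q true k A B * col q ε₂ ε' k j B := by
  have h : (fun s : Occ n => -num k s / 2) = fun s => (-1 / 2) * num k s := by
    funext s; ring
  rw [h, ← sum_row_smul hq ε true ε₂ ε' hik, ← h]
  simp only [← wMat_false hq]

theorem E_of_lt (q : ℝ) {i j : Fin n} (h : i < j) : E q i j = obs q true false i j := if_pos h

theorem E_of_gt (q : ℝ) {i j : Fin n} (h : i < j) : E q j i = obs q false true i j := by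
  rw [E, if_neg h.not_gt, if_pos h]

theorem E_self (q : ℝ) (i : Fin n) : E q i i = diagOp fun s => num i s + 1 := by
  rw [E, if_neg (lt_irrefl i), if_neg (lt_irrefl i)]

theorem F_of_lt (q : ℝ) {i j : Fin n} (h : i < j) : F q i j = obs q false false i j := if_pos h

theorem F_of_gt (q : ℝ) {i j : Fin n} (h : i < j) : F q j i = -obs q false false i j := by
  rw [F, if_neg h.not_gt, if_pos h]

theorem Ft_of_lt (q : ℝ) {i j : Fin n} (h : i < j) : Ft q i j = -obs q true true i j := if_pos h

theorem Ft_of_gt (q : ℝ) {i j : Fin n} (h : i < j) : Ft q j i = obs q true true i j := by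
  rw [Ft, if_neg h.not_gt, if_pos h]

theorem lt_of_succ {i k : Fin n} (h : (i : ℕ) + 1 = k) : i < k := by
  rw [Fin.lt_def]; omega

theorem F_succ (hq : 0 < q) {i k j : Fin n} (hik : i < k) (hkj : (k : ℕ) + 1 = j) :
    F q i j = F q i k * E q k j - q ^ (1 / 2 : ℝ) • (E q k j * F q i k) := by
  have h := lt_of_succ hkj
  rw [F_of_lt q (hik.trans h), F_of_lt q hik, E_of_lt q h, obs_mul_obs_true hq _ _ hik h,
    sum_row_right hq _ _ _ hik hkj]

theorem Ft_succ (hq : 0 < q) {i k j : Fin n} (hik : i < k) (hkj : (k : ℕ) + 1 = j) :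
    Ft q i j = E q j k * Ft q i k - q ^ (-1 / 2 : ℝ) • (Ft q i k * E q j k) := by
  have h := lt_of_succ hkj
  rw [Ft_of_lt q (hik.trans h), Ft_of_lt q hik, E_of_gt q h, ← sum_row_right hq _ false _ hik hkj,
    ← obs_false_mul_obs hq _ _ hik h]
  simp only [mul_neg, neg_mul, smul_neg]
  abel

theorem qPow_half_cancel (hq : 0 < q) (k : Fin n) (X : Op n) :
    qPow q (fun s => num k s / 2) * (qPow q (fun s => -num k s / 2) * X) = X := by
  rw [← mul_assoc, qPow_mul hq]
  simp [neg_div, qPow_zero]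

theorem qPow_half_cancel' (hq : 0 < q) (k : Fin n) (X : Op n) :
    qPow q (fun s => -num k s / 2) * (qPow q (fun s => num k s / 2) * X) = X := by
  rw [← mul_assoc, qPow_mul hq]
  simp [neg_div, qPow_zero]

/-- The inserted flux carries `q^{-N_k/4}` while the chain of `E q i j` needs `q^{N_k/4}`, hence the
prefactor; in `F_succ` the two signs agree. -/
theorem E_succ (hq : 0 < q) {i k j : Fin n} (hik : i < k) (hkj : (k : ℕ) + 1 = j) :
    E q i j = qPow q (fun s => num k s / 2) *
      (E q i k * E q k j - q ^ (1 / 2 : ℝ) • (E q k j * E q i k)) := by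
  have h := lt_of_succ hkj
  rw [E_of_lt q (hik.trans h), E_of_lt q hik, E_of_lt q h, obs_mul_obs_true hq _ _ hik h,
    sum_row_false hq _ _ _ hik, sum_row_right hq _ _ _ hik hkj, qPow_half_cancel hq]

theorem E_succ' (hq : 0 < q) {i k j : Fin n} (hik : i < k) (hkj : (k : ℕ) + 1 = j) :
    E q j i = qPow q (fun s => -num k s / 2) *
      (E q j k * E q k i - q ^ (-1 / 2 : ℝ) • (E q k i * E q j k)) := by
  have h := lt_of_succ hkj
  rw [E_of_gt q (hik.trans h), E_of_gt q hik, E_of_gt q h, obs_false_mul_obs hq _ _ hik h,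
    sum_row_true hq _ _ _ hik, sum_row_right hq _ _ _ hik hkj, qPow_half_cancel' hq]

theorem F_pred (hq : 0 < q) {i k j : Fin n} (hik : (i : ℕ) + 1 = k) (hkj : k < j) :
    F q i j = qPow q (fun s => -num k s / 2) *
      (F q k j * E q k i - q ^ (-1 / 2 : ℝ) • (E q k i * F q k j)) := by
  have h := lt_of_succ hik
  rw [F_of_lt q (h.trans hkj), F_of_lt q hkj, E_of_gt q h, obs_false_mul_obs hq _ _ h hkj,
    sum_row_true hq _ _ _ h, sum_row_left hq _ _ hik hkj, qPow_half_cancel' hq]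

theorem Ft_pred (hq : 0 < q) {i k j : Fin n} (hik : (i : ℕ) + 1 = k) (hkj : k < j) :
    Ft q i j = qPow q (fun s => num k s / 2) *
      (E q i k * Ft q k j - q ^ (1 / 2 : ℝ) • (Ft q k j * E q i k)) := by
  have h := lt_of_succ hik
  have h1 : obs q true true i j = qPow q (fun s => num k s / 2) *
      (obs q true false i k * obs q true true k j
        - q ^ (1 / 2 : ℝ) • (obs q true true k j * obs q true false i k)) := by
    rw [obs_mul_obs_true hq _ _ h hkj, sum_row_false hq _ _ _ h, sum_row_left hq _ _ hik hkj,
      qPow_half_cancel hq]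
  rw [Ft_of_lt q (h.trans hkj), Ft_of_lt q hkj, E_of_lt q h, h1, ← mul_neg]
  congr 1
  simp only [mul_neg, neg_mul, smul_neg]
  abel

end Exchange

/-! ### Generators on the same pair of adjacent edges. -/

/-- The exchange relations between the components of the annihilation spinor `(a, b)` and of the
creation spinor `(a', b')` at one edge. -/
structure SpinorRel {R : Type*} [Ring R] [Algebra ℝ R] (p : ℝ) (a b a' b' : R) : Prop where
  a_mul_b' : a * b' = b' * a
  b_mul_a' : b * a' = a' * b
  b_mul_a : b * a = p ^ 2 • (a * b)
  a'_mul_b' : a' * b' = p ^ 2 • (b' * a')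
  diag : a * a' - p ^ 2 • (a' * a) = b * b' - p⁻¹ ^ 2 • (b' * b)

theorem mul_mul_mul_of_commute {R : Type*} [Ring R] {x y z w : R} (h : Commute y z) :
    x * y * (z * w) = x * z * (y * w) := by
  rw [mul_assoc, ← mul_assoc y, h.eq, mul_assoc, mul_assoc]

section Pair

variable {R : Type*} [Ring R] [Algebra ℝ R] {p : ℝ} {a b a' b' c d c' d' : R}

/-- The two edges carry inverse parameters, so the scalars from reordering compensate. The
expressions are the adjacent `E`, its reverse, `F` and `Ft`. In the mixed commutators what survives
reordering is a multiple of one edge's `diag` relation; in the last two only the products diagonal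
in the occupation basis survive. -/
theorem SpinorRel.pair (hp : p ≠ 0) (h : SpinorRel p a b a' b') (h' : SpinorRel p⁻¹ c d c' d')
    (hc : ∀ x ∈ ({a, b, a', b'} : Set R), ∀ y ∈ ({c, d, c', d'} : Set R), Commute y x) :
    Commute (a' * c + b' * d) (p • (a * d) - p⁻¹ • (b * c)) ∧
    Commute (b * d' + a * c') (p • (a * d) - p⁻¹ • (b * c)) ∧
    Commute (a' * c + b' * d) (p • (a' * d') - p⁻¹ • (b' * c')) ∧
    Commute (b * d' + a * c') (p • (a' * d') - p⁻¹ • (b' * c')) ∧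
    (a' * c + b' * d) * (b * d' + a * c') - (b * d' + a * c') * (a' * c + b' * d) =
      a' * a * (c * c') - a * a' * (c' * c) + (b' * b * (d * d') - b * b' * (d' * d)) ∧
    (p • (a * d) - p⁻¹ • (b * c)) * (p • (a' * d') - p⁻¹ • (b' * c')) -
        (p • (a' * d') - p⁻¹ • (b' * c')) * (p • (a * d) - p⁻¹ • (b * c)) =
      p ^ 2 • (a * a' * (d * d') - a' * a * (d' * d)) +
        p⁻¹ ^ 2 • (b * b' * (c * c') - b' * b * (c' * c)) := by
  -- Used as rewriting rules, these sort each quartic word into first-edge factors followed by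
  -- second-edge factors.
  have hm : ∀ x ∈ ({a, b, a', b'} : Set R), ∀ y ∈ ({c, d, c', d'} : Set R), ∀ z w,
      z * y * (x * w) = z * x * (y * w) := fun x hx y hy z w =>
    mul_mul_mul_of_commute (hc x hx y hy)
  simp only [Set.mem_insert_iff, Set.mem_singleton_iff, forall_eq_or_imp, forall_eq] at hm
  obtain ⟨⟨h1, h2, h3, h4⟩, ⟨h5, h6, h7, h8⟩, ⟨h9, h10, h11, h12⟩, h13, h14, h15, h16⟩ := hm
  have k1 := h.a_mul_b'
  have k2 := h.b_mul_a'
  have k3 := h.b_mul_a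
  have k4 := h.a'_mul_b'
  have k5 := h.diag
  have l1 := h'.a_mul_b'
  have l2 := h'.b_mul_a'
  have l3 := h'.b_mul_a
  have l4 := h'.a'_mul_b'
  have l5 := h'.diag
  rw [inv_inv] at l5
  simp only [Commute, SemiconjBy, mul_add, add_mul, mul_sub, sub_mul, smul_mul_assoc,
    mul_smul_comm, h1, h2, h3, h4, h5, h6, h7, h8, h9, h10, h11, h12, h13, h14, h15, h16,
    k1, k2, k3, k4, l1, l2, l3, l4]
  refine ⟨?_, ?_, ?_, ?_, ?_, ?_⟩
  · have e := congrArg (· * (c * d)) k5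
    simp only [sub_mul, smul_mul_assoc] at e
    linear_combination (norm := skip) (-p⁻¹) • e
    match_scalars <;> field_simp <;> ring
  · have e := congrArg (a * b * ·) l5
    simp only [mul_sub, mul_smul_comm] at e
    linear_combination (norm := skip) p • e
    match_scalars <;> field_simp <;> ring
  · have e := congrArg (b' * a' * ·) l5
    simp only [mul_sub, mul_smul_comm] at e
    linear_combination (norm := skip) (-p) • e
    match_scalars <;> field_simp <;> ring
  · have e := congrArg (· * (d' * c')) k5
    simp only [sub_mul, smul_mul_assoc] at e
    linear_combination (norm := skip) p⁻¹ • e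
    match_scalars <;> field_simp <;> ring
  · module
  · match_scalars <;> field_simp <;> ring

end Pair

section Diagonal

variable {q : ℝ}

/-- The q-analogue of `x(y+1) - (x+1)y = x - y`. It evaluates the diagonal terms of the commutator
of adjacent `E`'s; the next lemma does the same for `F` with `Ft`. -/
theorem qInt_mul_sub (hq : 0 < q) (x y : ℝ) :
    qInt q x * qInt q (y + 1) - qInt q (x + 1) * qInt q y = qInt q (x - y) := by
  rw [sub_eq_add_neg x y, qInt_add hq x (-y), qInt_neg, qInt_add_one hq x, qInt_add_one hq y]
  ring

theorem qInt_succ_mul_succ (hq : 0 < q) (x y : ℝ) :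
    qInt q (x + 1) * qInt q (y + 1) - qInt q x * qInt q y = qInt q (x + y + 1) := by
  have e : q ^ (1 / 2 : ℝ) * q ^ (-1 / 2 : ℝ) = 1 := by
    rw [← Real.rpow_add hq]; norm_num
  have e2 : q ^ ((y + 1) / 2) = q ^ (1 / 2 : ℝ) * q ^ (y / 2) := by
    rw [← Real.rpow_add hq]; ring_nf
  rw [add_assoc x y, qInt_add hq x (y + 1), qInt_add_one hq x, qInt_add_one' hq y, e2]
  linear_combination qInt q x * qInt q y * e

theorem inv_rpow_quarter (hq : 0 < q) : (q ^ (1 / 4 : ℝ))⁻¹ = q ^ (-1 / 4 : ℝ) := by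
  rw [← Real.rpow_neg hq.le]; norm_num

theorem sq_rpow_quarter (hq : 0 < q) : (q ^ (1 / 4 : ℝ)) ^ 2 = q ^ (1 / 2 : ℝ) := by
  rw [← Real.rpow_mul_natCast hq.le]; norm_num

theorem sq_rpow_neg_quarter (hq : 0 < q) : (q ^ (-1 / 4 : ℝ)) ^ 2 = q ^ (-1 / 2 : ℝ) := by
  rw [← Real.rpow_mul_natCast hq.le]; norm_num

theorem spinorRel_one (hq : 0 < q) (i : Fin n) :
    SpinorRel (q ^ (1 / 4 : ℝ)) (annA q 1 i) (annB q 1 i) (creA q 1 i) (creB q 1 i) where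
  a_mul_b' := by rw [annA_mul_creB hq]; norm_num
  b_mul_a' := by rw [annB_mul_creA hq]; norm_num
  b_mul_a := by rw [annB_mul_annA hq, sq_rpow_quarter hq]; norm_num
  a'_mul_b' := by rw [creA_mul_creB hq, sq_rpow_quarter hq]; norm_num
  -- Both sides are `q^{(N_b - N_a)/2}`.
  diag := by
    rw [annA_mul_creA hq, creA_mul_annA hq, annB_mul_creB hq, creB_mul_annB hq,
      inv_rpow_quarter hq, sq_rpow_neg_quarter hq, sq_rpow_quarter hq, smul_diagOp, smul_diagOp,
      diagOp_sub, diagOp_sub]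
    congr 1; funext s
    rw [qInt_add_one hq, qInt_add_one' hq,
      show (1 + 1) * numB i s / 4 = numB i s / 2 by ring,
      show -(1 + 1) * numA i s / 4 = -numA i s / 2 by ring]
    ring

theorem spinorRel_neg_one (hq : 0 < q) (i : Fin n) :
    SpinorRel (q ^ (1 / 4 : ℝ))⁻¹ (annA q (-1) i) (annB q (-1) i) (creA q (-1) i)
      (creB q (-1) i) where
  a_mul_b' := by rw [annA_mul_creB hq]; norm_num
  b_mul_a' := by rw [annB_mul_creA hq]; norm_num
  b_mul_a := by rw [annB_mul_annA hq, inv_rpow_quarter hq, sq_rpow_neg_quarter hq]; norm_num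
  a'_mul_b' := by rw [creA_mul_creB hq, inv_rpow_quarter hq, sq_rpow_neg_quarter hq]; norm_num
  diag := by
    rw [annA_mul_creA hq, creA_mul_annA hq, annB_mul_creB hq, creB_mul_annB hq, inv_inv,
      inv_rpow_quarter hq, sq_rpow_neg_quarter hq, sq_rpow_quarter hq, smul_diagOp, smul_diagOp,
      diagOp_sub, diagOp_sub]
    congr 1; funext s
    rw [qInt_add_one' hq, qInt_add_one hq,
      show (-1 + -1) * numB i s / 4 = -numB i s / 2 by ring,
      show -(-1 + -1) * numA i s / 4 = numA i s / 2 by ring]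
    ring

end Diagonal

section Adjacent

variable {q : ℝ} {i j : Fin n}

theorem obs_adjacent (hq : 0 < q) (ε ε' : Bool) (h : (i : ℕ) + 1 = j) :
    obs q ε ε' i j =
      uSpinor q i ε 0 * tauSpinor q j ε' 0 + uSpinor q i ε 1 * tauSpinor q j ε' 1 := by
  simp only [obs_eq_col hq, col_adjacent ε ε' h, Fin.sum_univ_two]

theorem E_adjacent (hq : 0 < q) (h : (i : ℕ) + 1 = j) :
    E q i j = creA q 1 i * annA q (-1) j + creB q 1 i * annB q (-1) j := by
  rw [E_of_lt q (lt_of_succ h), obs_adjacent hq _ _ h, uSpinor_true_zero hq, uSpinor_true_one hq,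
    tauSpinor_false_zero, tauSpinor_false_one]

theorem rpow_quarter_ne (hq : 0 < q) : q ^ (1 / 4 : ℝ) ≠ 0 := (Real.rpow_pos_of_pos hq _).ne'

theorem E_adjacent' (hq : 0 < q) (h : (i : ℕ) + 1 = j) :
    E q j i = annB q 1 i * creB q (-1) j + annA q 1 i * creA q (-1) j := by
  rw [E_of_gt q (lt_of_succ h), obs_adjacent hq _ _ h, uSpinor_false_zero, uSpinor_false_one,
    tauSpinor_true_zero hq, tauSpinor_true_one hq, neg_mul_neg, smul_mul_smul_comm,
    smul_mul_smul_comm, ← inv_rpow_quarter hq, mul_inv_cancel₀ (rpow_quarter_ne hq),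
    inv_mul_cancel₀ (rpow_quarter_ne hq), one_smul, one_smul]

theorem F_adjacent (hq : 0 < q) (h : (i : ℕ) + 1 = j) :
    F q i j = q ^ (1 / 4 : ℝ) • (annA q 1 i * annB q (-1) j)
      - (q ^ (1 / 4 : ℝ))⁻¹ • (annB q 1 i * annA q (-1) j) := by
  rw [F_of_lt q (lt_of_succ h), obs_adjacent hq _ _ h, uSpinor_false_zero, uSpinor_false_one,
    tauSpinor_false_zero, tauSpinor_false_one, inv_rpow_quarter hq, neg_mul, smul_mul_assoc,
    smul_mul_assoc]
  abel

theorem Ft_adjacent (hq : 0 < q) (h : (i : ℕ) + 1 = j) :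
    Ft q i j = q ^ (1 / 4 : ℝ) • (creA q 1 i * creB q (-1) j)
      - (q ^ (1 / 4 : ℝ))⁻¹ • (creB q 1 i * creA q (-1) j) := by
  rw [Ft_of_lt q (lt_of_succ h), obs_adjacent hq _ _ h, uSpinor_true_zero hq, uSpinor_true_one hq,
    tauSpinor_true_zero hq, tauSpinor_true_one hq, inv_rpow_quarter hq, mul_neg, mul_smul_comm,
    mul_smul_comm]
  abel

theorem commute_sites {X Y : Op n} (hij : i ≠ j) (hX : X ∈ siteAlg q {i})
    (hY : Y ∈ siteAlg q {j}) : Commute Y X :=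
  (commute_of_mem_siteAlg (by simpa using hij) hX hY).symm

theorem adjacent_pair (hq : 0 < q) (h : (i : ℕ) + 1 = j) :
    Commute (E q i j) (F q i j) ∧ Commute (E q j i) (F q i j) ∧
    Commute (E q i j) (Ft q i j) ∧ Commute (E q j i) (Ft q i j) ∧
    E q i j * E q j i - E q j i * E q i j =
      qNum q (fun s => (num i s + 1) - (num j s + 1)) ∧
    F q i j * Ft q i j - Ft q i j * F q i j =
      qNum q (fun s => (num i s + 1) + (num j s + 1)) := by
  have hij : i ≠ j := (lt_of_succ h).ne
  have key := (spinorRel_one hq i).pair (rpow_quarter_ne hq) (spinorRel_neg_one hq j) (by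
    intro x hx y hy
    refine commute_sites (q := q) hij ?_ ?_
    · rcases hx with rfl | rfl | rfl | rfl
      exacts [annA_mem q 1 i, annB_mem q 1 i, creA_mem q 1 i, creB_mem q 1 i]
    · rcases hy with rfl | rfl | rfl | rfl
      exacts [annA_mem q _ j, annB_mem q _ j, creA_mem q _ j, creB_mem q _ j])
  rw [← E_adjacent hq h, ← E_adjacent' hq h, ← F_adjacent hq h, ← Ft_adjacent hq h] at key
  obtain ⟨k1, k2, k3, k4, k5, k6⟩ := key
  refine ⟨k1, k2, k3, k4, ?_, ?_⟩
  · rw [k5, annA_mul_creA hq, creA_mul_annA hq, annB_mul_creB hq, creB_mul_annB hq,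
      annA_mul_creA hq, creA_mul_annA hq, annB_mul_creB hq, creB_mul_annB hq]
    simp only [diagOp_mul, diagOp_sub, diagOp_add, qNum]
    congr 1; funext s
    -- With this splitting, the two terms of `qInt_add` are the contributions of the `a`-modes and
    -- of the `b`-modes.
    have e : num i s + 1 - (num j s + 1) = (numA i s - numA j s) + (numB i s - numB j s) := by
      simp only [num]; ring
    have e1 : q ^ ((numB i s - numB j s) / 2) =
        q ^ ((1 + 1) * numB i s / 4) * q ^ ((-1 + -1) * numB j s / 4) := by
      rw [← Real.rpow_add hq]; ring_nf
    have e2 : q ^ (-(numA i s - numA j s) / 2) =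
        q ^ (-(1 + 1) * numA i s / 4) * q ^ (-(-1 + -1) * numA j s / 4) := by
      rw [← Real.rpow_add hq]; ring_nf
    rw [e, qInt_add hq (numA i s - numA j s), ← qInt_mul_sub hq, ← qInt_mul_sub hq, e1, e2]
    ring
  · rw [k6, annA_mul_creA hq, creA_mul_annA hq, annB_mul_creB hq, creB_mul_annB hq,
      annA_mul_creA hq, creA_mul_annA hq, annB_mul_creB hq, creB_mul_annB hq,
      inv_rpow_quarter hq, sq_rpow_neg_quarter hq, sq_rpow_quarter hq]
    simp only [diagOp_mul, diagOp_sub, diagOp_add, smul_diagOp, qNum]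
    congr 1; funext s
    -- The grouping pairs `a` at one edge with `b` at the other, as the bilinears in `F` and `Ft`
    -- do.
    have e : num i s + 1 + (num j s + 1) =
        (numA i s + numB j s + 1) + (numB i s + numA j s + 1) := by
      simp only [num]; ring
    have e1 : q ^ ((numB i s + numA j s + 1) / 2) = q ^ (1 / 2 : ℝ) *
        q ^ ((1 + 1) * numB i s / 4) * q ^ (-(-1 + -1) * numA j s / 4) := by
      rw [← Real.rpow_add hq, ← Real.rpow_add hq]; ring_nf
    have e2 : q ^ (-(numA i s + numB j s + 1) / 2) = q ^ (-1 / 2 : ℝ) *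
        q ^ (-(1 + 1) * numA i s / 4) * q ^ ((-1 + -1) * numB j s / 4) := by
      rw [← Real.rpow_add hq, ← Real.rpow_add hq]; ring_nf
    rw [e, qInt_add hq (numA i s + numB j s + 1), ← qInt_succ_mul_succ hq,
      ← qInt_succ_mul_succ hq, e1, e2]
    ring

end Adjacent

/-! ### Grading by boson number. -/

/-- `X` raises the number of bosons at the edge `i` by `g`. -/
def HasGrade (q : ℝ) (i : Fin n) (g : ℝ) (X : Op n) : Prop := ⁅E q i i, X⁆ = g • X

section Grade

variable {q : ℝ} {i : Fin n} {g g' : ℝ} {X Y : Op n}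

/-- The bracket is a derivation, so grades add. -/
theorem HasGrade.mul (hX : HasGrade q i g X) (hY : HasGrade q i g' Y) :
    HasGrade q i (g + g') (X * Y) := by
  unfold HasGrade at *
  rw [Ring.lie_def] at *
  have e : E q i i * (X * Y) - X * Y * E q i i =
      (E q i i * X - X * E q i i) * Y + X * (E q i i * Y - Y * E q i i) := by noncomm_ring
  rw [e, hX, hY, smul_mul_assoc, mul_smul_comm, add_smul]

theorem HasGrade.add (hX : HasGrade q i g X) (hY : HasGrade q i g Y) :
    HasGrade q i g (X + Y) := by
  unfold HasGrade at *
  rw [Ring.lie_def] at *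
  rw [mul_add, add_mul, add_sub_add_comm, hX, hY, smul_add]

theorem HasGrade.neg (hX : HasGrade q i g X) : HasGrade q i g (-X) := by
  unfold HasGrade at *
  rw [Ring.lie_def] at *
  rw [mul_neg, neg_mul, ← neg_sub', hX, smul_neg]

theorem HasGrade.smul (r : ℝ) (hX : HasGrade q i g X) : HasGrade q i g (r • X) := by
  unfold HasGrade at *
  rw [Ring.lie_def] at *
  rw [mul_smul_comm, smul_mul_assoc, ← smul_sub, hX, smul_comm]

theorem hasGrade_diagOp (q : ℝ) (i : Fin n) (c : Occ n → ℝ) : HasGrade q i 0 (diagOp c) := by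
  rw [HasGrade, E_self, zero_smul]
  exact (commute_iff_lie_eq).1 (commute_diagOp _ _)

theorem num_up (i : Fin n) (m : Fin n × Fin 2) (s : Occ n) :
    num i (up s m) = num i s + δ i m.1 := by
  by_cases h : m.1 = i
  · obtain ⟨j, x⟩ := m
    simp only at h
    subst h
    have h1 : num j (up s (j, 0)) = num j s + δ j j := by
      simp only [num, numA_up, numB_up', δ, if_pos]; ring
    have h2 : num j (up s (j, 1)) = num j s + δ j j := by
      rw [← num_up_eq, h1]
    fin_cases x
    · exact h1
    · exact h2
  · rw [num_up_of_ne h, δ, if_neg (Ne.symm h), add_zero]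

theorem hasGrade_creat (q : ℝ) (i : Fin n) (m : Fin n × Fin 2) :
    HasGrade q i (δ i m.1) (creat q m) := by
  have h : diagOp (fun s : Occ n => num i s + δ i m.1 + 1) =
      diagOp (fun s => num i s + 1) + δ i m.1 • 1 := by
    rw [← diagOp_one, smul_diagOp, diagOp_add]
    congr 1; funext s; ring
  rw [HasGrade, E_self, Ring.lie_def, diagOp_mul_creat]
  simp only [num_up, h, mul_add, mul_smul_comm, mul_one, add_sub_cancel_left]

theorem hasGrade_annih (q : ℝ) (i : Fin n) (m : Fin n × Fin 2) :
    HasGrade q i (-δ i m.1) (annih q m) := by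
  have h : diagOp (fun s : Occ n => num i s + δ i m.1 + 1) =
      diagOp (fun s => num i s + 1) + δ i m.1 • 1 := by
    rw [← diagOp_one, smul_diagOp, diagOp_add]
    congr 1; funext s; ring
  rw [HasGrade, E_self, Ring.lie_def, annih_mul_diagOp]
  simp only [num_up, h, add_mul, smul_mul_assoc, one_mul, neg_smul]
  abel

theorem hasGrade_uSpinor (q : ℝ) (i j : Fin n) (ε : Bool) (A : Fin 2) :
    HasGrade q i (sgn ε * δ i j) (uSpinor q j ε A) := by
  refine HasGrade.smul _ ?_
  have h0 : ∀ f : Occ n → ℝ, HasGrade q i 0 (qPow q f) := fun f => hasGrade_diagOp q i _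
  have hc := fun x => hasGrade_creat q i (j, x)
  have ha := fun x => hasGrade_annih q i (j, x)
  generalize A.rev = A
  cases ε <;> fin_cases A <;> simp only [Fin.zero_eta, Fin.mk_one, tSpinor, Matrix.cons_val_one,
    Matrix.cons_val_zero, sgn]
  · simpa using (h0 _).mul (ha 0)
  · simpa using (h0 _).mul (ha 1)
  · simpa using ((hc 1).mul (h0 _)).neg
  · simpa using (hc 0).mul (h0 _)

theorem hasGrade_tauSpinor (q : ℝ) (i j : Fin n) (ε : Bool) (A : Fin 2) :
    HasGrade q i (sgn ε * δ i j) (tauSpinor q j ε A) := by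
  have h0 : ∀ f : Occ n → ℝ, HasGrade q i 0 (qPow q f) := fun f => hasGrade_diagOp q i _
  have hc := fun x => hasGrade_creat q i (j, x)
  have ha := fun x => hasGrade_annih q i (j, x)
  cases ε <;> fin_cases A <;> simp only [Fin.zero_eta, Fin.mk_one, tauSpinor, Matrix.cons_val_one,
    Matrix.cons_val_zero, sgn]
  · simpa using (h0 _).mul (ha 0)
  · simpa using (h0 _).mul (ha 1)
  · simpa using ((hc 1).mul (h0 _)).neg
  · simpa using (hc 0).mul (h0 _)

theorem hasGrade_obs (hq : 0 < q) (i : Fin n) (ε ε' : Bool) {j k : Fin n}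
    (h : (j : ℕ) + 1 = k) :
    HasGrade q i (sgn ε * δ i j + sgn ε' * δ i k) (obs q ε ε' j k) := by
  rw [obs_adjacent hq ε ε' h]
  exact ((hasGrade_uSpinor q i j ε 0).mul (hasGrade_tauSpinor q i k ε' 0)).add
    ((hasGrade_uSpinor q i j ε 1).mul (hasGrade_tauSpinor q i k ε' 1))

theorem lie_E_self (q : ℝ) (i j : Fin n) : ⁅E q i i, E q j j⁆ = 0 := by
  rw [E_self, E_self]
  exact (commute_iff_lie_eq).1 (commute_diagOp _ _)

theorem lie_E_self_adjacent (hq : 0 < q) (i : Fin n) {j j' : Fin n} (h : (j : ℕ) + 1 = j') :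
    ⁅E q i i, E q j j'⁆ = (δ i j - δ i j') • E q j j' ∧
    ⁅E q i i, E q j' j⁆ = (δ i j' - δ i j) • E q j' j ∧
    ⁅E q i i, F q j j'⁆ = -((δ i j + δ i j') • F q j j') ∧
    ⁅E q i i, Ft q j j'⁆ = (δ i j + δ i j') • Ft q j j' := by
  have hl := lt_of_succ h
  rw [E_of_lt q hl, E_of_gt q hl, F_of_lt q hl, Ft_of_lt q hl]
  refine ⟨?_, ?_, ?_, ?_⟩
  · rw [hasGrade_obs hq i true false h]
    congr 1; simp [sgn]; ring
  · rw [hasGrade_obs hq i false true h]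
    congr 1; simp [sgn]; ring
  · rw [hasGrade_obs hq i false false h, ← neg_smul]
    congr 1; simp [sgn]; ring
  · rw [(hasGrade_obs hq i true true h).neg]
    congr 1; simp [sgn]

end Grade

/-! ### Relations among the generators. -/

section Relations

variable {q : ℝ}

theorem obs_adjacent_mem (hq : 0 < q) (ε ε' : Bool) {i j : Fin n} (h : (i : ℕ) + 1 = j) :
    obs q ε ε' i j ∈ siteAlg q {i, j} := by
  rw [obs_adjacent hq ε ε' h]
  have h1 := fun A => siteAlg_mono q (T := {i, j}) (by simp) (uSpinor_mem hq i ε A)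
  have h2 := fun A => siteAlg_mono q (T := {i, j}) (by simp) (tauSpinor_mem hq j ε' A)
  exact add_mem (mul_mem (h1 0) (h2 0)) (mul_mem (h1 1) (h2 1))

theorem lie_eq_zero_of_commute {X Y : Op n} (h : Commute X Y) : ⁅X, Y⁆ = 0 :=
  commute_iff_lie_eq.1 h

theorem relations_self (hq : 0 < q) {i i' : Fin n} (hi : (i : ℕ) + 1 = i') :
    ⁅E q i i', E q i' i⁆ = qNum q (fun s => (num i s + 1) - (num i' s + 1)) ∧
    E q i i' * F q i i' - F q i i' * E q i i' = 0 ∧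
    E q i' i * F q i i' - F q i i' * E q i' i = 0 ∧
    E q i i' * Ft q i i' - Ft q i i' * E q i i' = 0 ∧
    E q i' i * Ft q i i' - Ft q i i' * E q i' i = 0 ∧
    F q i i' * Ft q i i' - Ft q i i' * F q i i' =
      qNum q (fun s => (num i s + 1) + (num i' s + 1)) := by
  obtain ⟨h1, h2, h3, h4, h5, h6⟩ := adjacent_pair hq hi
  exact ⟨h5, sub_eq_zero.2 h1, sub_eq_zero.2 h2, sub_eq_zero.2 h3, sub_eq_zero.2 h4, h6⟩

theorem commute_of_ne (hq : 0 < q) (ε₁ ε₂ ε₃ ε₄ : Bool) {i i' j j' : Fin n} (hi : (i : ℕ) + 1 = i')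
    (hj : (j : ℕ) + 1 = j') (h1 : i ≠ j) (h2 : i' ≠ j) (h3 : i ≠ j') :
    Commute (obs q ε₁ ε₂ i i') (obs q ε₃ ε₄ j j') := by
  refine commute_of_mem_siteAlg ?_ (obs_adjacent_mem hq ε₁ ε₂ hi) (obs_adjacent_mem hq ε₃ ε₄ hj)
  have h4 : i' ≠ j' := by
    rintro rfl
    exact h1 (Fin.ext (by omega))
  simp [Set.disjoint_left, h1, h2, h3, h4]

end Relations

/-- The pairs `(i, i')` and `(j, j')` coincide, share one edge in one of two ways, or are disjoint.
At a shared edge, equal signs give commutation, and opposite signs give a recursion solved for its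
q-commutator. -/
theorem generator_relations {q : ℝ} (hq : 0 < q) {i i' j j' : Fin n} (hi : (i : ℕ) + 1 = i')
    (hj : (j : ℕ) + 1 = j') :
    ⁅E q i i', E q j' j⁆ = δ i j • qNum q (fun s => (num i s + 1) - (num i' s + 1)) ∧
    E q i i' * F q j j' - q ^ (-δ i j' / 2) • (F q j j' * E q i i') =
      (δ i j' * q ^ (-1 / 2 : ℝ)) • F q i' j ∧
    q ^ (-δ i' j / 2) • (E q i' i * F q j j') - F q j j' * E q i' i =
      -(δ i' j • (qPow q (fun s => num i' s / 2) * F q i j')) ∧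
    E q i i' * Ft q j j' - q ^ (δ i' j / 2) • (Ft q j j' * E q i i') =
      δ i' j • (qPow q (fun s => -num i' s / 2) * Ft q i j') ∧
    q ^ (δ i j' / 2) • (E q i' i * Ft q j j') - Ft q j j' * E q i' i =
      -((δ i j' * q ^ (1 / 2 : ℝ)) • Ft q i' j) ∧
    F q i i' * Ft q j j' - q ^ ((δ i' j - δ i j') / 2) • (Ft q j j' * F q i i') =
      δ i j • qNum q (fun s => (num i s + 1) + (num i' s + 1))
        - δ i' j • E q j' i - δ i j' • E q j i' ∧
    ⁅F q i i', F q j j'⁆ = 0 ∧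
    ⁅Ft q i i', Ft q j j'⁆ = 0 := by
  have e1 : q ^ (1 / 2 : ℝ) * q ^ (-1 / 2 : ℝ) = 1 := by
    rw [← Real.rpow_add hq]; norm_num
  have e2 : q ^ (-1 / 2 : ℝ) * q ^ (1 / 2 : ℝ) = 1 := by
    rw [← Real.rpow_add hq]; norm_num
  have hli := lt_of_succ hi
  have hlj := lt_of_succ hj
  rcases eq_or_ne i j with rfl | hij
  · obtain rfl : i' = j' := Fin.ext (by omega)
    have d1 : δ i i' = 0 := if_neg hli.ne
    have d2 : δ i' i = 0 := if_neg hli.ne'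
    have d3 : δ i i = 1 := if_pos rfl
    obtain ⟨h1, h2, h3, h4, h5, h6⟩ := relations_self hq hi
    simp only [d1, d2, d3, neg_zero, zero_div, Real.rpow_zero, one_smul, zero_mul, zero_smul,
      sub_zero]
    exact ⟨h1, h2, h3, h4, h5, h6, lie_eq_zero_of_commute (Commute.refl _),
      lie_eq_zero_of_commute (Commute.refl _)⟩
  have d0 : δ i j = 0 := if_neg hij
  rcases eq_or_ne i' j with rfl | hi'j
  · have hij' : i ≠ j' := fun h => by subst h; exact lt_asymm hli hlj
    have d1 : δ i j' = 0 := if_neg hij'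
    have d3 : δ i' i' = 1 := if_pos rfl
    have c := fun ε ε₁ ε' => commute_obs_chain hq ε ε₁ ε' hli hlj
    have r1 := F_pred hq hi hlj
    have r2 := Ft_pred hq hi hlj
    simp only [d0, d1, d3, neg_zero, zero_div, Real.rpow_zero, one_smul, zero_mul, zero_smul,
      sub_zero, zero_sub]
    refine ⟨?_, ?_, ?_, ?_, ?_, ?_, ?_, ?_⟩
    · rw [E_of_lt q hli, E_of_gt q hlj]
      exact lie_eq_zero_of_commute (c _ _ _)
    · rw [E_of_lt q hli, F_of_lt q hlj, (c _ _ _).eq, sub_self]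
    · rw [r1, qPow_half_cancel hq]
      abel
    · rw [r2, qPow_half_cancel' hq]
    · rw [E_of_gt q hli, Ft_of_lt q hlj, (c _ _ _).neg_right.eq, sub_self]
    -- The inserted flux has the same dressing sign as the chain from `i`, so no power of `N`
    -- appears; the minus sign is the one in the definition of `Ft`.
    · rw [F_of_lt q hli, Ft_of_lt q hlj, E_of_gt q (hli.trans hlj),
        ← sum_row_right hq false true true hli hj, ← obs_mul_obs_true hq _ _ hli hlj]
      simp only [mul_neg, neg_mul, smul_neg]
      abel
    · rw [F_of_lt q hli, F_of_lt q hlj]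
      exact lie_eq_zero_of_commute (c _ _ _)
    · rw [Ft_of_lt q hli, Ft_of_lt q hlj]
      exact lie_eq_zero_of_commute (c _ _ _).neg_left.neg_right
  have d2 : δ i' j = 0 := if_neg hi'j
  rcases eq_or_ne i j' with rfl | hij'
  · have d3 : δ i i = 1 := if_pos rfl
    have c := fun ε ε₁ ε' => (commute_obs_chain hq ε ε₁ ε' hlj hli).symm
    have r1 := F_succ hq hlj hi
    have r2 := Ft_succ hq hlj hi
    have f1 : F q i' j = -F q j i' := by
      rw [F_of_gt q (hlj.trans hli), F_of_lt q (hlj.trans hli)]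
    have f2 : Ft q i' j = -Ft q j i' := by
      rw [Ft_of_gt q (hlj.trans hli), Ft_of_lt q (hlj.trans hli), neg_neg]
    simp only [d0, d2, d3, neg_zero, zero_div, Real.rpow_zero, one_smul, zero_smul,
      sub_zero, zero_sub, one_mul]
    refine ⟨?_, ?_, ?_, ?_, ?_, ?_, ?_, ?_⟩
    · rw [E_of_lt q hli, E_of_gt q hlj]
      exact lie_eq_zero_of_commute (c _ _ _)
    · rw [f1, r1, smul_neg, smul_sub, smul_smul, e2, one_smul]
      abel
    · rw [E_of_gt q hli, F_of_lt q hlj, (c _ _ _).eq, sub_self]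
    · rw [E_of_lt q hli, Ft_of_lt q hlj, (c _ _ _).neg_right.eq, sub_self]
    · rw [f2, r2, smul_neg, smul_sub, smul_smul, e1, one_smul, neg_neg]
    · rw [F_of_lt q hli, Ft_of_lt q hlj, E_of_lt q (hlj.trans hli),
        ← sum_row_right hq true false false hlj hi, ← obs_false_mul_obs hq _ _ hlj hli]
      simp only [mul_neg, neg_mul, smul_neg]
      abel
    · rw [F_of_lt q hli, F_of_lt q hlj]
      exact lie_eq_zero_of_commute (c _ _ _)
    · rw [Ft_of_lt q hli, Ft_of_lt q hlj]
      exact lie_eq_zero_of_commute (c _ _ _).neg_left.neg_right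
  have d1 : δ i j' = 0 := if_neg hij'
  have c := fun ε₁ ε₂ ε₃ ε₄ => commute_of_ne hq ε₁ ε₂ ε₃ ε₄ hi hj hij hi'j hij'
  simp only [d0, d1, d2, neg_zero, zero_div, Real.rpow_zero, one_smul, zero_mul, zero_smul,
    sub_zero, sub_eq_zero]
  rw [E_of_lt q hli, E_of_gt q hlj, E_of_gt q hli, F_of_lt q hli, F_of_lt q hlj, Ft_of_lt q hli,
    Ft_of_lt q hlj]
  exact ⟨lie_eq_zero_of_commute (c _ _ _ _), c _ _ _ _, c _ _ _ _, (c _ _ _ _).neg_right,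
    (c _ _ _ _).neg_right, (c _ _ _ _).neg_right, lie_eq_zero_of_commute (c _ _ _ _),
    lie_eq_zero_of_commute (c _ _ _ _).neg_left.neg_right⟩

/-! ### Generation of all observables. -/

section Generation

variable (q : ℝ)

theorem Uu_le_Uso : Uu q n ≤ Uso q n := Algebra.adjoin_mono Set.subset_union_left

theorem real_smul_mem {S : Subalgebra ℂ (Op n)} {X : Op n} (r : ℝ) (h : X ∈ S) : r • X ∈ S := by
  have : r • X = (r : ℂ) • X := (Complex.coe_smul r X).symm
  rw [this]
  exact S.smul_mem h _

theorem qPow_half_mem {q : ℝ} (hq : 0 < q) (k : Fin n) :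
    qPow q (fun s => num k s / 2) ∈ Uu q n ∧ qPow q (fun s => -num k s / 2) ∈ Uu q n := by
  have h1 : qPow q (fun s => (num k s + 1) / 2) ∈ Uu q n :=
    Algebra.subset_adjoin (Or.inl ⟨k, Or.inr (Or.inl rfl)⟩)
  have h2 : qPow q (fun s => -(num k s + 1) / 2) ∈ Uu q n :=
    Algebra.subset_adjoin (Or.inl ⟨k, Or.inr (Or.inr rfl)⟩)
  -- The generators contain `N + 1`; rescaling by `q^{∓1/2}` removes the shift.
  have h3 := real_smul_mem (q ^ (-1 / 2 : ℝ)) h1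
  have h4 := real_smul_mem (q ^ (1 / 2 : ℝ)) h2
  rw [smul_qPow hq] at h3 h4
  constructor
  · convert h3 using 3; ring
  · convert h4 using 3; ring

theorem succ_induction {P : Fin n → Fin n → Prop}
    (h0 : ∀ i j : Fin n, (i : ℕ) + 1 = j → P i j)
    (h1 : ∀ i k j : Fin n, i < k → (k : ℕ) + 1 = j → P i k → P i j) :
    ∀ i j : Fin n, i < j → P i j := by
  intro i j
  obtain ⟨m, hm⟩ := j
  induction m with
  | zero => intro h; exact absurd h (Nat.not_lt_zero _)
  | succ m ih =>
    intro h
    have h' : (i : ℕ) < m + 1 := h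
    rcases Nat.lt_or_ge (i : ℕ) m with h2 | h2
    · exact h1 i ⟨m, by omega⟩ _ h2 rfl (ih (by omega) h2)
    · exact h0 i _ (by simp only; omega)

theorem E_mem {q : ℝ} (hq : 0 < q) (i j : Fin n) : E q i j ∈ Uu q n := by
  have hg : ∀ i j : Fin n, (i : ℕ) + 1 = j → E q i j ∈ Uu q n ∧ E q j i ∈ Uu q n := fun i j h =>
    ⟨Algebra.subset_adjoin (Or.inr ⟨i, j, h, Or.inl rfl⟩),
      Algebra.subset_adjoin (Or.inr ⟨i, j, h, Or.inr rfl⟩)⟩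
  have key : ∀ i j : Fin n, i < j → E q i j ∈ Uu q n ∧ E q j i ∈ Uu q n := by
    refine succ_induction hg fun i k j hik hkj h => ?_
    obtain ⟨h1, h2⟩ := hg k j hkj
    rw [E_succ hq hik hkj, E_succ' hq hik hkj]
    exact ⟨mul_mem (qPow_half_mem hq k).1
        (sub_mem (mul_mem h.1 h1) (real_smul_mem _ (mul_mem h1 h.1))),
      mul_mem (qPow_half_mem hq k).2
        (sub_mem (mul_mem h2 h.2) (real_smul_mem _ (mul_mem h.2 h2)))⟩
  rcases lt_trichotomy i j with h | rfl | h
  · exact (key i j h).1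
  · exact Algebra.subset_adjoin (Or.inl ⟨i, Or.inl rfl⟩)
  · exact (key j i h).2

theorem F_mem {q : ℝ} (hq : 0 < q) (i j : Fin n) : F q i j ∈ Uso q n ∧ Ft q i j ∈ Uso q n := by
  have hE := fun i j : Fin n => Uu_le_Uso q (E_mem hq i j)
  have hg : ∀ i j : Fin n, (i : ℕ) + 1 = j → F q i j ∈ Uso q n ∧ Ft q i j ∈ Uso q n := fun i j h =>
    ⟨Algebra.subset_adjoin (Or.inr ⟨i, j, h, Or.inl rfl⟩),
      Algebra.subset_adjoin (Or.inr ⟨i, j, h, Or.inr rfl⟩)⟩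
  have key : ∀ i j : Fin n, i < j → F q i j ∈ Uso q n ∧ Ft q i j ∈ Uso q n := by
    refine succ_induction hg fun i k j hik hkj h => ?_
    rw [F_succ hq hik hkj, Ft_succ hq hik hkj]
    exact ⟨sub_mem (mul_mem h.1 (hE _ _)) (real_smul_mem _ (mul_mem (hE _ _) h.1)),
      sub_mem (mul_mem (hE _ _) h.2) (real_smul_mem _ (mul_mem h.2 (hE _ _)))⟩
  rcases lt_trichotomy i j with h | rfl | h
  · exact key i j h
  · simp only [F, Ft, lt_irrefl, if_false]
    exact ⟨zero_mem _, zero_mem _⟩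
  · obtain ⟨h1, h2⟩ := key j i h
    rw [F_of_lt q h] at h1
    rw [Ft_of_lt q h] at h2
    rw [F_of_gt q h, Ft_of_gt q h]
    exact ⟨neg_mem h1, by simpa using neg_mem h2⟩

end Generation

/-! ### Continuity of matrix elements at `q = 1`. -/

theorem op_apply_eq_sum (X : Op n) {v : Fock n} {S : Finset (Occ n)} (h : v.support ⊆ S) :
    X v = ∑ u ∈ S, v u • X (Finsupp.single u 1) := by
  have hv : v = ∑ u ∈ S, v u • Finsupp.single u (1 : ℂ) := by
    conv_lhs => rw [← Finsupp.sum_single v]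
    rw [Finsupp.sum_of_support_subset _ h _ (by simp)]
    simp
  conv_lhs => rw [hv]
  rw [map_sum]
  exact Finset.sum_congr rfl fun u _ => map_smul X _ _

/-- The matrix elements of the family `X` in the occupation basis are continuous at `1`, and for
each basis state only finitely many of them are ever nonzero. -/
def ContElem (X : ℝ → Op n) : Prop :=
  ∀ s, (∃ S : Finset (Occ n), ∀ q, (X q (Finsupp.single s 1)).support ⊆ S) ∧
    ∀ t, ContinuousAt (fun q => X q (Finsupp.single s 1) t) 1

namespace ContElem

variable {X Y : ℝ → Op n}

theorem add (hX : ContElem X) (hY : ContElem Y) : ContElem fun q => X q + Y q := by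
  classical
  intro s
  obtain ⟨⟨S, hS⟩, hc⟩ := hX s
  obtain ⟨⟨T, hT⟩, hd⟩ := hY s
  refine ⟨⟨S ∪ T, fun q => ?_⟩, fun t => (hc t).add (hd t)⟩
  exact Finsupp.support_add.trans (Finset.union_subset_union (hS q) (hT q))

/-- The Fock space is infinite-dimensional in general, so entrywise continuity alone need not
survive products. The support bound uniform in `q` turns each entry of the product into a fixed
finite sum. -/
theorem mul (hX : ContElem X) (hY : ContElem Y) : ContElem fun q => X q * Y q := by
  classical
  intro s
  obtain ⟨⟨S, hS⟩, hc⟩ := hY s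
  have h : ∀ q, (X q * Y q) (Finsupp.single s 1) =
      ∑ u ∈ S, (Y q (Finsupp.single s 1)) u • X q (Finsupp.single u 1) := fun q =>
    op_apply_eq_sum (X q) (hS q)
  choose T hT using fun u => (hX u).1
  refine ⟨⟨S.biUnion T, fun q => ?_⟩, fun t => ?_⟩
  · rw [h]
    refine Finsupp.support_finsetSum.trans (Finset.biUnion_mono fun u _ => ?_)
    exact Finsupp.support_smul.trans (hT u q)
  · simp only [h, Finsupp.finsetSum_apply, Finsupp.smul_apply, smul_eq_mul]
    exact tendsto_finsetSum _ fun u _ => (hc u).mul ((hX u).2 t)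

theorem smul {r : ℝ → ℝ} (hr : ContinuousAt r 1) (hX : ContElem X) :
    ContElem fun q => r q • X q := by
  intro s
  obtain ⟨⟨S, hS⟩, hc⟩ := hX s
  refine ⟨⟨S, fun q => ?_⟩, fun t => hr.smul (hc t)⟩
  exact Finsupp.support_smul.trans (hS q)

theorem neg (hX : ContElem X) : ContElem fun q => -X q := by
  have := hX.smul (r := fun _ => -1) continuousAt_const
  simpa using this

theorem of_single {c : Occ n → ℝ → ℝ} {f : Occ n → Occ n}
    (h : ∀ q s, X q (Finsupp.single s 1) = c s q • Finsupp.single (f s) (1 : ℂ))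
    (hc : ∀ s, ContinuousAt (c s) 1) : ContElem X := by
  intro s
  refine ⟨⟨{f s}, fun q => ?_⟩, fun t => ?_⟩
  · rw [h]
    exact Finsupp.support_smul.trans Finsupp.support_single_subset
  · simp only [h, Finsupp.smul_apply]
    exact (hc s).smul continuousAt_const

theorem diagOp {c : ℝ → Occ n → ℝ} (hc : ∀ s, ContinuousAt (fun q => c q s) 1) :
    ContElem fun q => QSpin.diagOp (c q) :=
  of_single (c := fun s q => c q s) (f := id) (fun q s => diagOp_single (c q) s) hc

theorem rpow_const (x : ℝ) : ContinuousAt (fun q : ℝ => q ^ x) 1 :=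
  Real.continuousAt_rpow_const 1 x (Or.inl one_ne_zero)

theorem qPow (f : Occ n → ℝ) : ContElem fun q => QSpin.qPow q f :=
  diagOp fun s => rpow_const (f s)

/-- The recursion `[k+1] = q^{1/2}[k] + q^{-k/2}` holds for all `q > 0`, including 1, so no limit of
the defining quotient is needed. -/
theorem continuousAt_qInt (k : ℕ) : ContinuousAt (fun q : ℝ => qInt q k) 1 := by
  induction k with
  | zero => simpa [qInt_zero] using continuousAt_const
  | succ k ih =>
    have h : (fun q : ℝ => qInt q (k + 1 : ℕ)) =ᶠ[𝓝 1]
        fun q => q ^ (1 / 2 : ℝ) * qInt q k + q ^ (-(k : ℝ) / 2) := by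
      filter_upwards [lt_mem_nhds (zero_lt_one (α := ℝ))] with q hq
      rw [Nat.cast_succ, qInt_add_one hq]
    exact (((rpow_const _).mul ih).add (rpow_const _)).congr h.symm

theorem annih (m : Fin n × Fin 2) : ContElem fun q => QSpin.annih q m :=
  of_single (f := fun s => down s m) (fun q s => annih_single q m s) fun s =>
    (continuousAt_qInt (s m)).sqrt

theorem creat (m : Fin n × Fin 2) : ContElem fun q => QSpin.creat q m :=
  of_single (f := fun s => up s m) (fun q s => creat_single q m s) fun s => by
    have := (continuousAt_qInt (s m + 1)).sqrt
    push_cast at this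
    exact this

theorem zero : ContElem fun _ => (0 : Op n) := fun s => by
  refine ⟨⟨∅, fun q => by simp⟩, fun t => continuousAt_const⟩

theorem one : ContElem fun _ => (1 : Op n) := by
  rw [← diagOp_one]
  exact diagOp fun s => continuousAt_const

theorem sum {ι : Type*} (I : Finset ι) {Z : ι → ℝ → Op n} (h : ∀ i, ContElem (Z i)) :
    ContElem fun q => ∑ i ∈ I, Z i q := by
  classical
  induction I using Finset.induction_on with
  | empty => simpa using zero
  | insert a I ha ih =>
    simp only [Finset.sum_insert ha]
    exact (h a).add ih

theorem tSpinor (i : Fin n) (ε : Bool) (A : Fin 2) : ContElem fun q => QSpin.tSpinor q i ε A := by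
  cases ε <;> fin_cases A <;> simp only [Fin.zero_eta, Fin.mk_one, QSpin.tSpinor,
    Matrix.cons_val_one, Matrix.cons_val_zero]
  exacts [(qPow _).mul (annih _), (qPow _).mul (annih _), ((creat _).mul (qPow _)).neg,
    (creat _).mul (qPow _)]

theorem tauSpinor (i : Fin n) (ε : Bool) (A : Fin 2) :
    ContElem fun q => QSpin.tauSpinor q i ε A := by
  cases ε <;> fin_cases A <;> simp only [Fin.zero_eta, Fin.mk_one, QSpin.tauSpinor,
    Matrix.cons_val_one, Matrix.cons_val_zero]
  exacts [(qPow _).mul (annih _), (qPow _).mul (annih _), ((creat _).mul (qPow _)).neg,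
    (creat _).mul (qPow _)]

theorem flux (k : Fin n) (A B : Fin 2) : ContElem fun q => QSpin.flux q k A B := by
  fin_cases A <;> fin_cases B <;> simp only [Fin.zero_eta, Fin.mk_one, QSpin.flux,
    Matrix.of_apply, Matrix.cons_val', Matrix.cons_val_one, Matrix.cons_val_zero]
  exacts [qPow _, (((annih _).mul (creat _)).smul
    ((rpow_const _).mul ((rpow_const _).sub (rpow_const _)))).neg, zero, qPow _]

theorem prod_flux (l : List (Fin n)) (A B : Fin 2) :
    ContElem fun q => (l.map fun k => QSpin.flux q k).prod A B := by
  induction l generalizing A with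
  | nil =>
    simp only [List.map_nil, List.prod_nil, Matrix.one_apply]
    split_ifs
    exacts [one, zero]
  | cons k l ih =>
    simp only [List.map_cons, List.prod_cons, Matrix.mul_apply]
    exact sum _ fun C => (flux k A C).mul (ih C)

theorem obs (ε ε' : Bool) (i j : Fin n) : ContElem fun q => QSpin.obs q ε ε' i j :=
  (qPow _).mul <| sum _ fun A => sum _ fun B => ((((tSpinor i ε A.rev).mul
    (prod_flux _ A B)).mul (tauSpinor j ε' B)).smul (continuousAt_const.mul (rpow_const _)))

theorem E (i j : Fin n) : ContElem fun q => QSpin.E q i j := by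
  unfold QSpin.E
  split_ifs
  exacts [obs _ _ _ _, obs _ _ _ _, diagOp fun s => continuousAt_const]

theorem F (i j : Fin n) : ContElem fun q => QSpin.F q i j := by
  unfold QSpin.F
  split_ifs
  exacts [obs _ _ _ _, (obs _ _ _ _).neg, zero]

theorem Ft (i j : Fin n) : ContElem fun q => QSpin.Ft q i j := by
  unfold QSpin.Ft
  split_ifs
  exacts [(obs _ _ _ _).neg, obs _ _ _ _, zero]

end ContElem

/-! ### The Lie algebra at `q = 1`. -/

section RingBracket

variable {R : Type*} [Ring R]

theorem ring_lie_add (x y z : R) : ⁅x, y + z⁆ = ⁅x, y⁆ + ⁅x, z⁆ := by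
  simp only [Ring.lie_def]; noncomm_ring

theorem ring_add_lie (x y z : R) : ⁅x + y, z⁆ = ⁅x, z⁆ + ⁅y, z⁆ := by
  simp only [Ring.lie_def]; noncomm_ring

theorem ring_lie_sub (x y z : R) : ⁅x, y - z⁆ = ⁅x, y⁆ - ⁅x, z⁆ := by
  simp only [Ring.lie_def]; noncomm_ring

theorem ring_sub_lie (x y z : R) : ⁅x - y, z⁆ = ⁅x, z⁆ - ⁅y, z⁆ := by
  simp only [Ring.lie_def]; noncomm_ring

theorem lie_mul_mul (x y z w : R) :
    ⁅x * y, z * w⁆ = x * ⁅y, z⁆ * w + ⁅x, z⁆ * y * w + z * x * ⁅y, w⁆ + z * ⁅x, w⁆ * y := by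
  simp only [Ring.lie_def]
  noncomm_ring

theorem lie_swap_of_eq {x y z : R} (h : ⁅x, y⁆ = z) : ⁅y, x⁆ = -z := by
  rw [← h, Ring.lie_def, Ring.lie_def, neg_sub]

theorem mul_swap_of_lie {x y z : R} (h : ⁅x, y⁆ = z) : x * y = y * x + z := by
  rw [← h, Ring.lie_def]; abel

end RingBracket

section CanonicalCommutation

variable {R ι : Type*} [Ring R] [Algebra ℝ R]

/-- Two species of bosons `a`, `b` indexed by `ι`, with creation operators `a'`, `b'`. -/
structure BosonRel (d : ι → ι → ℝ) (a b a' b' : ι → R) : Prop where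
  symm : ∀ i j, d i j = d j i
  aa : ∀ i j, ⁅a i, a j⁆ = 0
  ab : ∀ i j, ⁅a i, b j⁆ = 0
  bb : ∀ i j, ⁅b i, b j⁆ = 0
  a'a' : ∀ i j, ⁅a' i, a' j⁆ = 0
  a'b' : ∀ i j, ⁅a' i, b' j⁆ = 0
  b'b' : ∀ i j, ⁅b' i, b' j⁆ = 0
  aa' : ∀ i j, ⁅a i, a' j⁆ = d i j • 1
  bb' : ∀ i j, ⁅b i, b' j⁆ = d i j • 1
  ab' : ∀ i j, ⁅a i, b' j⁆ = 0
  ba' : ∀ i j, ⁅b i, a' j⁆ = 0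

theorem lie_smul_one (r : ℝ) (x : R) : ⁅x, r • (1 : R)⁆ = 0 := by
  simp [Ring.lie_def]

theorem smul_one_lie (r : ℝ) (x : R) : ⁅r • (1 : R), x⁆ = 0 := by
  simp [Ring.lie_def]

/-- Brackets of bilinears in bosons are again bilinears. The central term in `e` drops out of
brackets with `e`, but it is what closes the bracket of `f` with `g`. -/
theorem BosonRel.lie {d : ι → ι → ℝ} {a b a' b' : ι → R} (h : BosonRel d a b a' b')
    {e f g : ι → ι → R} (he : ∀ i j, e i j = a' i * a j + b' i * b j + d i j • 1)
    (hf : ∀ i j, f i j = a i * b j - b i * a j)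
    (hg : ∀ i j, g i j = a' i * b' j - b' i * a' j) (i j k l : ι) :
    ⁅e i j, e k l⁆ = d j k • e i l - d i l • e k j ∧
    ⁅e i j, f k l⁆ = d i l • f j k - d i k • f j l ∧
    ⁅e i j, g k l⁆ = d j k • g i l - d j l • g i k ∧
    ⁅f i j, g k l⁆ = d j l • e k i + d i k • e l j - d j k • e l i - d i l • e k j ∧
    ⁅f i j, f k l⁆ = 0 ∧ ⁅g i j, g k l⁆ = 0 := by
  -- These rules fix a normal order, creators before annihilators and `a` before `b`, so that both
  -- sides become comparable term by term.
  have s1 := fun i j => mul_swap_of_lie (lie_swap_of_eq (h.ab j i))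
  have s2 := fun i j => mul_swap_of_lie (lie_swap_of_eq (h.a'b' j i))
  have s3 := fun i j => mul_swap_of_lie (h.aa' i j)
  have s4 := fun i j => mul_swap_of_lie (h.bb' i j)
  have s5 := fun i j => mul_swap_of_lie (h.ab' i j)
  simp only [neg_zero, add_zero] at s1 s2 s5
  simp only [he, hf, hg, ring_add_lie, ring_lie_add, ring_sub_lie, ring_lie_sub,
    lie_smul_one, smul_one_lie,
    lie_mul_mul, h.aa, h.ab, h.bb, h.a'a', h.a'b', h.b'b', h.aa', h.bb', h.ab', h.ba',
    fun i j => lie_swap_of_eq (h.ab i j), fun i j => lie_swap_of_eq (h.a'b' i j),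
    fun i j => lie_swap_of_eq (h.aa' i j), fun i j => lie_swap_of_eq (h.bb' i j),
    fun i j => lie_swap_of_eq (h.ab' i j), fun i j => lie_swap_of_eq (h.ba' i j),
    mul_neg, neg_mul, mul_smul_comm, smul_mul_assoc, mul_one, one_mul, mul_zero, zero_mul,
    neg_zero, add_zero, zero_add, sub_self, s1, s2, s3, s4, s5,
    h.symm k i, h.symm k j, h.symm l i, h.symm l j, and_self, and_true]
  refine ⟨?_, ?_, ?_, ?_⟩ <;> module

end CanonicalCommutation

section Undeformed

theorem qPow_one (f : Occ n → ℝ) : qPow 1 f = 1 := by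
  simp [qPow, diagOp_one]

/-- The off-diagonal entry carries the factor `q^{1/2} - q^{-1/2}`, which vanishes here; parallel
transport becomes trivial. -/
theorem wMat_one (ε : Bool) (k : Fin n) : wMat 1 ε k = 1 := by
  ext1 A B
  fin_cases A <;> fin_cases B <;> simp only [Fin.zero_eta, Fin.mk_one]
  · rw [wMat_zero_zero one_pos, qPow_one, Matrix.one_apply_eq]
  · rw [wMat_zero_one]; simp
  · rw [wMat_one_zero]; simp
  · rw [wMat_one_one one_pos, qPow_one, Matrix.one_apply_eq]

theorem obs_one (ε ε' : Bool) (i j : Fin n) : obs 1 ε ε' i j =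
    uSpinor 1 i ε 0 * tauSpinor 1 j ε' 0 + uSpinor 1 i ε 1 * tauSpinor 1 j ε' 1 := by
  have h : wProd 1 ε (between i j) = 1 := by
    rw [wProd, funext (wMat_one ε), List.map_const', List.prod_replicate, one_pow]
  simp [obs_eq_sum one_pos, h, Matrix.one_apply]

theorem annA_one (κ : ℝ) (i : Fin n) : annA 1 κ i = annih 1 (i, 0) := by
  rw [annA, qPow_one, one_mul]

theorem annB_one (κ : ℝ) (i : Fin n) : annB 1 κ i = annih 1 (i, 1) := by
  rw [annB, qPow_one, one_mul]

theorem creA_one (κ : ℝ) (i : Fin n) : creA 1 κ i = creat 1 (i, 0) := by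
  rw [creA, qPow_one, mul_one]

theorem creB_one (κ : ℝ) (i : Fin n) : creB 1 κ i = creat 1 (i, 1) := by
  rw [creB, qPow_one, mul_one]

theorem obs_one_false_false (i j : Fin n) : obs 1 false false i j =
    annih 1 (i, 0) * annih 1 (j, 1) - annih 1 (i, 1) * annih 1 (j, 0) := by
  rw [obs_one, uSpinor_false_zero, uSpinor_false_one, tauSpinor_false_zero, tauSpinor_false_one]
  simp only [annA_one, annB_one, Real.one_rpow, one_smul, neg_mul]
  abel

theorem obs_one_true_true (i j : Fin n) : obs 1 true true i j =
    creat 1 (i, 1) * creat 1 (j, 0) - creat 1 (i, 0) * creat 1 (j, 1) := by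
  rw [obs_one, uSpinor_true_zero one_pos, uSpinor_true_one one_pos, tauSpinor_true_zero one_pos,
    tauSpinor_true_one one_pos]
  simp only [creA_one, creB_one, Real.one_rpow, one_smul, mul_neg]
  abel

theorem obs_one_true_false (i j : Fin n) : obs 1 true false i j =
    creat 1 (i, 0) * annih 1 (j, 0) + creat 1 (i, 1) * annih 1 (j, 1) := by
  rw [obs_one, uSpinor_true_zero one_pos, uSpinor_true_one one_pos, tauSpinor_false_zero,
    tauSpinor_false_one]
  simp only [creA_one, creB_one, annA_one, annB_one]

theorem obs_one_false_true (i j : Fin n) : obs 1 false true i j =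
    annih 1 (i, 1) * creat 1 (j, 1) + annih 1 (i, 0) * creat 1 (j, 0) := by
  rw [obs_one, uSpinor_false_zero, uSpinor_false_one, tauSpinor_true_zero one_pos,
    tauSpinor_true_one one_pos]
  simp only [creA_one, creB_one, annA_one, annB_one, Real.one_rpow, one_smul, neg_mul_neg]

theorem lie_annih (m m' : Fin n × Fin 2) : ⁅annih (n := n) 1 m, annih 1 m'⁆ = 0 := by
  by_cases h : m = m'
  · subst h; exact lie_eq_zero_of_commute (Commute.refl _)
  · exact lie_eq_zero_of_commute (commute_annih 1 h)

theorem lie_creat (m m' : Fin n × Fin 2) : ⁅creat (n := n) 1 m, creat 1 m'⁆ = 0 := by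
  by_cases h : m = m'
  · subst h; exact lie_eq_zero_of_commute (Commute.refl _)
  · exact lie_eq_zero_of_commute (commute_creat 1 h)

theorem lie_annih_creat (i j : Fin n) (x : Fin 2) :
    ⁅annih (n := n) 1 (i, x), creat 1 (j, x)⁆ = δ i j • 1 := by
  by_cases h : i = j
  · subst h
    rw [Ring.lie_def, annih_mul_creat one_pos, creat_mul_annih one_pos, diagOp_sub, δ, if_pos rfl,
      one_smul, ← diagOp_one]
    congr 1; funext s
    rw [qInt_one_left, qInt_one_left]; ring
  · rw [lie_eq_zero_of_commute (commute_annih_creat 1 (by simpa using h)), δ, if_neg h, zero_smul]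

theorem bosonRel_one : BosonRel δ (fun i : Fin n => annih 1 (i, 0)) (fun i => annih 1 (i, 1))
    (fun i => creat 1 (i, 0)) (fun i => creat 1 (i, 1)) where
  symm i j := by simp [δ, eq_comm]
  aa _ _ := lie_annih _ _
  ab _ _ := lie_annih _ _
  bb _ _ := lie_annih _ _
  a'a' _ _ := lie_creat _ _
  a'b' _ _ := lie_creat _ _
  b'b' _ _ := lie_creat _ _
  aa' i j := lie_annih_creat i j 0
  bb' i j := lie_annih_creat i j 1
  ab' _ _ := lie_eq_zero_of_commute (commute_annih_creat 1 (by simp))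
  ba' _ _ := lie_eq_zero_of_commute (commute_annih_creat 1 (by simp))

theorem E_one (i j : Fin n) : E 1 i j = creat 1 (i, 0) * annih 1 (j, 0) +
    creat 1 (i, 1) * annih 1 (j, 1) + δ i j • 1 := by
  rcases lt_trichotomy i j with h | rfl | h
  · rw [E_of_lt 1 h, obs_one_true_false, δ, if_neg h.ne, zero_smul, add_zero]
  · rw [E_self, creat_mul_annih one_pos, creat_mul_annih one_pos, δ, if_pos rfl, ← diagOp_one,
      smul_diagOp, diagOp_add, diagOp_add]
    congr 1; funext s
    simp only [qInt_one_left, num, numA, numB]; ring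
  · have hc : ∀ x, annih (n := n) 1 (j, x) * creat 1 (i, x) = creat 1 (i, x) * annih 1 (j, x) :=
      fun x => commute_annih_creat 1 (by simpa using h.ne)
    rw [E_of_gt 1 h, obs_one_false_true, hc, hc, δ, if_neg h.ne', zero_smul, add_zero, add_comm]

theorem F_one (i j : Fin n) : F 1 i j =
    annih 1 (i, 0) * annih 1 (j, 1) - annih 1 (i, 1) * annih 1 (j, 0) := by
  have hc : ∀ i j : Fin n, annih (n := n) 1 (i, 1) * annih 1 (j, 0) =
      annih 1 (j, 0) * annih 1 (i, 1) := fun i j => commute_annih 1 (by simp)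
  rcases lt_trichotomy i j with h | rfl | h
  · rw [F_of_lt 1 h, obs_one_false_false]
  · rw [hc, sub_self, F, if_neg (lt_irrefl _), if_neg (lt_irrefl _)]
  · rw [F_of_gt 1 h, obs_one_false_false, hc, hc, neg_sub]

theorem Ft_one (i j : Fin n) : Ft 1 i j =
    creat 1 (i, 0) * creat 1 (j, 1) - creat 1 (i, 1) * creat 1 (j, 0) := by
  have hc : ∀ i j : Fin n, creat (n := n) 1 (i, 1) * creat 1 (j, 0) =
      creat 1 (j, 0) * creat 1 (i, 1) := fun i j => commute_creat 1 (by simp)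
  rcases lt_trichotomy i j with h | rfl | h
  · rw [Ft_of_lt 1 h, obs_one_true_true, neg_sub]
  · rw [hc, sub_self, Ft, if_neg (lt_irrefl _), if_neg (lt_irrefl _)]
  · rw [Ft_of_gt 1 h, obs_one_true_true, hc, hc]

end Undeformed

end QSpin

end

theorem mainTheorem8 (n : ℕ) :
    (∀ q : ℝ, 0 < q →
      -- recursion relations; `k = j - 1`, then `k = i + 1`
      (∀ i k j : Fin n, i < k → (k : ℕ) + 1 = j →
        QSpin.F q i j = QSpin.F q i k * QSpin.E q k j
          - q ^ (1 / 2 : ℝ) • (QSpin.E q k j * QSpin.F q i k) ∧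
        QSpin.Ft q i j = QSpin.E q j k * QSpin.Ft q i k
          - q ^ (-1 / 2 : ℝ) • (QSpin.Ft q i k * QSpin.E q j k)) ∧
      (∀ i k j : Fin n, (i : ℕ) + 1 = k → k < j →
        QSpin.F q i j = QSpin.qPow q (fun s => -QSpin.num k s / 2) *
          (QSpin.F q k j * QSpin.E q k i
            - q ^ (-1 / 2 : ℝ) • (QSpin.E q k i * QSpin.F q k j)) ∧
        QSpin.Ft q i j = QSpin.qPow q (fun s => QSpin.num k s / 2) *
          (QSpin.E q i k * QSpin.Ft q k j
            - q ^ (1 / 2 : ℝ) • (QSpin.Ft q k j * QSpin.E q i k))) ∧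
      -- the `𝓔_{ij}` are the Cartan-Weyl generators of `U_q(u(n))`; `k = j - 1`
      (∀ i k j : Fin n, i < k → (k : ℕ) + 1 = j →
        QSpin.E q i j = QSpin.qPow q (fun s => QSpin.num k s / 2) *
          (QSpin.E q i k * QSpin.E q k j
            - q ^ (1 / 2 : ℝ) • (QSpin.E q k j * QSpin.E q i k)) ∧
        QSpin.E q j i = QSpin.qPow q (fun s => -QSpin.num k s / 2) *
          (QSpin.E q j k * QSpin.E q k i
            - q ^ (-1 / 2 : ℝ) • (QSpin.E q k i * QSpin.E q j k))) ∧
      -- commutators with `𝓔_i`; `j' = j + 1`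
      (∀ i j : Fin n, ⁅QSpin.E q i i, QSpin.E q j j⁆ = 0) ∧
      (∀ i j j' : Fin n, (j : ℕ) + 1 = j' →
        ⁅QSpin.E q i i, QSpin.E q j j'⁆ = (QSpin.δ i j - QSpin.δ i j') • QSpin.E q j j' ∧
        ⁅QSpin.E q i i, QSpin.E q j' j⁆ = (QSpin.δ i j' - QSpin.δ i j) • QSpin.E q j' j ∧
        ⁅QSpin.E q i i, QSpin.F q j j'⁆ = -((QSpin.δ i j + QSpin.δ i j') • QSpin.F q j j') ∧
        ⁅QSpin.E q i i, QSpin.Ft q j j'⁆ = (QSpin.δ i j + QSpin.δ i j') • QSpin.Ft q j j') ∧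
      -- relations among the other generators; `i' = i + 1` and `j' = j + 1`
      (∀ i i' j j' : Fin n, (i : ℕ) + 1 = i' → (j : ℕ) + 1 = j' →
        ⁅QSpin.E q i i', QSpin.E q j' j⁆ =
          QSpin.δ i j • QSpin.qNum q (fun s => (QSpin.num i s + 1) - (QSpin.num i' s + 1)) ∧
        QSpin.E q i i' * QSpin.F q j j'
            - q ^ (-QSpin.δ i j' / 2) • (QSpin.F q j j' * QSpin.E q i i') =
          (QSpin.δ i j' * q ^ (-1 / 2 : ℝ)) • QSpin.F q i' j ∧
        q ^ (-QSpin.δ i' j / 2) • (QSpin.E q i' i * QSpin.F q j j')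
            - QSpin.F q j j' * QSpin.E q i' i =
          -(QSpin.δ i' j • (QSpin.qPow q (fun s => QSpin.num i' s / 2) * QSpin.F q i j')) ∧
        QSpin.E q i i' * QSpin.Ft q j j'
            - q ^ (QSpin.δ i' j / 2) • (QSpin.Ft q j j' * QSpin.E q i i') =
          QSpin.δ i' j • (QSpin.qPow q (fun s => -QSpin.num i' s / 2) * QSpin.Ft q i j') ∧
        q ^ (QSpin.δ i j' / 2) • (QSpin.E q i' i * QSpin.Ft q j j')
            - QSpin.Ft q j j' * QSpin.E q i' i =
          -((QSpin.δ i j' * q ^ (1 / 2 : ℝ)) • QSpin.Ft q i' j) ∧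
        QSpin.F q i i' * QSpin.Ft q j j'
            - q ^ ((QSpin.δ i' j - QSpin.δ i j') / 2) • (QSpin.Ft q j j' * QSpin.F q i i') =
          QSpin.δ i j • QSpin.qNum q (fun s => (QSpin.num i s + 1) + (QSpin.num i' s + 1))
            - QSpin.δ i' j • QSpin.E q j' i - QSpin.δ i j' • QSpin.E q j i' ∧
        ⁅QSpin.F q i i', QSpin.F q j j'⁆ = 0 ∧
        ⁅QSpin.Ft q i i', QSpin.Ft q j j'⁆ = 0) ∧
      -- the algebra generated by these operators contains `U_q(u(n))` and all the observables
      QSpin.Uu q n ≤ QSpin.Uso q n ∧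
      (∀ i j : Fin n, QSpin.E q i j ∈ QSpin.Uu q n ∧
        QSpin.F q i j ∈ QSpin.Uso q n ∧ QSpin.Ft q i j ∈ QSpin.Uso q n)) ∧
    -- q-deformation: as `q → 1` the operators tend to those at `q = 1` (matrix element by matrix
    -- element), and the latter satisfy the commutation relations of the Lie algebra `so*(2n)`
    (∀ (i j : Fin n) (s t : QSpin.Occ n),
      Tendsto (fun q : ℝ => QSpin.E q i j (Finsupp.single s 1) t) (𝓝 1)
        (𝓝 (QSpin.E 1 i j (Finsupp.single s 1) t)) ∧
      Tendsto (fun q : ℝ => QSpin.F q i j (Finsupp.single s 1) t) (𝓝 1)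
        (𝓝 (QSpin.F 1 i j (Finsupp.single s 1) t)) ∧
      Tendsto (fun q : ℝ => QSpin.Ft q i j (Finsupp.single s 1) t) (𝓝 1)
        (𝓝 (QSpin.Ft 1 i j (Finsupp.single s 1) t))) ∧
    (∀ i j k l : Fin n,
      ⁅QSpin.E 1 i j, QSpin.E 1 k l⁆ =
        QSpin.δ j k • QSpin.E 1 i l - QSpin.δ i l • QSpin.E 1 k j ∧
      ⁅QSpin.E 1 i j, QSpin.F 1 k l⁆ =
        QSpin.δ i l • QSpin.F 1 j k - QSpin.δ i k • QSpin.F 1 j l ∧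
      ⁅QSpin.E 1 i j, QSpin.Ft 1 k l⁆ =
        QSpin.δ j k • QSpin.Ft 1 i l - QSpin.δ j l • QSpin.Ft 1 i k ∧
      ⁅QSpin.F 1 i j, QSpin.Ft 1 k l⁆ =
        QSpin.δ j l • QSpin.E 1 k i + QSpin.δ i k • QSpin.E 1 l j
          - QSpin.δ j k • QSpin.E 1 l i - QSpin.δ i l • QSpin.E 1 k j ∧
      ⁅QSpin.F 1 i j, QSpin.F 1 k l⁆ = 0 ∧
      ⁅QSpin.Ft 1 i j, QSpin.Ft 1 k l⁆ = 0) := by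
  refine ⟨fun q hq => ⟨fun i k j hik hkj => ?_, fun i k j hik hkj => ?_, fun i k j hik hkj => ?_,
    QSpin.lie_E_self q, fun i j j' h => QSpin.lie_E_self_adjacent hq i h,
    fun i i' j j' hi hj => QSpin.generator_relations hq hi hj, QSpin.Uu_le_Uso q, fun i j =>
      ⟨QSpin.E_mem hq i j, QSpin.F_mem hq i j⟩⟩, fun i j s t => ⟨(QSpin.ContElem.E i j s).2 t,
    (QSpin.ContElem.F i j s).2 t, (QSpin.ContElem.Ft i j s).2 t⟩, fun i j k l =>
    QSpin.bosonRel_one.lie QSpin.E_one QSpin.F_one QSpin.Ft_one i j k l⟩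
  · exact ⟨QSpin.F_succ hq hik hkj, QSpin.Ft_succ hq hik hkj⟩
  · exact ⟨QSpin.F_pred hq hik hkj, QSpin.Ft_pred hq hik hkj⟩
  · exact ⟨QSpin.E_succ hq hik hkj, QSpin.E_succ' hq hik hkj⟩
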